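/- Let $(V,q)$ be a finite-dimensional (nondegenerate) rational quadratic space of signature $(n,2)$ with $n\ge 1$, and let $G=\mathrm{SO}(V,q)$, a linear algebraic group over $\mathbb{Q}$. Let $\Gamma\subset G(\mathbb{Q})\cap G(\mathbb{R})^+$ be an arithmetic subgroup (that is, commensurable with the stabilizer in $G(\mathbb{Q})$ of a full lattice in $V$), let $K$ be a maximal compact subgroup of $G(\mathbb{R})$, and let $X=\Gamma\backslash G(\mathbb{R})/K$ be the associated orthogonal Shimura variety. If $H$ is a $\mathbb{Q}$-algebraic subgroup of $G$ such that, for some base point $gK\in G(\mathbb{R})/K$, the orbit $H(\mathbb{R})gK/K$ is a Hermitian symmetric subdomain (a totally geodesic complex submanifold) of $G(\mathbb{R})/K$, then the image of this orbit in $X$ is called a special subvariety of $X$ arising from $H$. It is called an orthogonal Shimura subvariety if it arises from $H=\mathrm{SO}(V',q')$ for a rational quadratic subspace $(V',q')$ of $(V,q)$ of signature $(r,2)$ with $r\ge 1$, where $H$ is embedded in $G$ as the pointwise stabilizer of the orthogonal complement of $V'$. A special subvariety is called strongly special if it arises from a semisimple $\mathbb{Q}$-subgroup $H$ of $G$ that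 is not contained in any proper parabolic $\mathbb{Q}$-subgroup of $G$. Here a parabolic $\mathbb{Q}$-subgroup of $G$ is an algebraic $\mathbb{Q}$-subgroup which, over an algebraically closed field, contains a Borel subgroup (a maximal connected solvable algebraic subgroup) of $G$, and a semisimple group is a connected one without nontrivial connected solvable normal algebraic subgroups over an algebraically closed field. Then every orthogonal Shimura subvariety of $X$ is strongly special. More precisely, for every rational quadratic subspace $(V',q')$ of $(V,q)$ of signature $(r,2)$ with $r\ge 1$, the group $\mathrm{SO}(V',q')$ is a semisimple $\mathbb{Q}$-subgroup of $G$ which is not contained in any proper parabolic $\mathbb{Q}$-subgroup of $G$. -/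

import Mathlib

open scoped TensorProduct

noncomputable section

namespace OrthogonalShimura

/-! ### Quadratic spaces and their special orthogonal groups -/

section Quadratic

variable {F M : Type*} [Field F] [AddCommGroup M] [Module F M]

/-- `Q` is nondegenerate of signature `(a, b)`: the maximal positive definite subspaces have
dimension `a`, the maximal negative definite ones have dimension `b`, and the space has
dimension `a + b`. -/
def HasSignature [LinearOrder F] (Q : QuadraticForm F M) (a b : ℕ) : Prop :=
  sigPos Q = a ∧ sigNeg Q = b ∧ Module.finrank F M = a + b

/-- The group of isometries of determinant one of a quadratic space, over the base field. -/
def specialOrthogonal (Q : QuadraticForm F M) : Subgroup (SpecialLinearGroup F M) where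
  carrier := {g | ∀ x, Q (g x) = Q x}
  one_mem' := fun _ => rfl
  mul_mem' := by
    intro a b ha hb x
    exact (ha (b x)).trans (hb x)
  inv_mem' := by
    intro a ha x
    have h := ha ((a⁻¹ : SpecialLinearGroup F M) x)
    have e : a ((a⁻¹ : SpecialLinearGroup F M) x) = x := a.val.apply_symm_apply x
    rw [e] at h
    exact h.symm

/-- The elements of `SO(Q)` which fix every vector of `S`. -/
def pointwiseStabilizer (Q : QuadraticForm F M) (S : Set M) :
    Subgroup (SpecialLinearGroup F M) where
  carrier := {g | g ∈ specialOrthogonal Q ∧ ∀ w ∈ S, g w = w}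
  one_mem' := ⟨(specialOrthogonal Q).one_mem, fun _ _ => rfl⟩
  mul_mem' := by
    rintro a b ⟨ha, ha'⟩ ⟨hb, hb'⟩
    refine ⟨(specialOrthogonal Q).mul_mem ha hb, fun w hw => ?_⟩
    have e : (a * b : SpecialLinearGroup F M) w = a (b w) := rfl
    rw [e, hb' w hw, ha' w hw]
  inv_mem' := by
    rintro a ⟨ha, ha'⟩
    refine ⟨(specialOrthogonal Q).inv_mem ha, fun w hw => ?_⟩
    have e : (a⁻¹ : SpecialLinearGroup F M) (a w) = w := a.val.symm_apply_apply w
    rwa [ha' w hw] at e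

/-- The orthogonal complement of a set of vectors. -/
def perp (Q : QuadraticForm F M) (S : Set M) : Set M :=
  {w | ∀ v ∈ S, QuadraticMap.polar Q v w = 0}

end Quadratic

variable {V : Type*} [AddCommGroup V] [Module ℚ V]

/-! ### Linear algebraic groups over `ℚ`

A linear algebraic group inside `SL(V)` is represented by its group of complex points, a
subgroup of `SL(V ⊗ ℂ)`. It is a `ℚ`-group if it is the zero locus of polynomials with rational
coefficients in the matrix coefficients. -/

/-- The matrix coefficients `φ (g v)` of `g ∈ SL(V ⊗ L)`, for `v ∈ V` and `φ` in the dual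
of `V`. -/
def matrixCoeff {L : Type*} [Field L] [Algebra ℚ L] (g : SpecialLinearGroup L (L ⊗[ℚ] V)) :
    V × Module.Dual ℚ V → L :=
  fun i => Module.Dual.baseChange L i.2 (g ((1 : L) ⊗ₜ[ℚ] i.1))

/-- The zero locus in `SL(V ⊗ ℂ)` of polynomials with coefficients in `k ⊆ ℂ` in the matrix
coefficients. -/
def zeroLocus {k : Type*} [Field k] [Algebra k ℂ]
    (I : Set (MvPolynomial (V × Module.Dual ℚ V) k)) :
    Set (SpecialLinearGroup ℂ (ℂ ⊗[ℚ] V)) :=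
  {g | ∀ p ∈ I, MvPolynomial.aeval (matrixCoeff g) p = 0}

variable (V) in
/-- The `k`-Zariski topology on `SL(V ⊗ ℂ)`, for `k ⊆ ℂ`: the closed sets are the zero loci of
polynomials with coefficients in `k`. -/
abbrev zariski (k : Type*) [Field k] [Algebra k ℂ] :
    TopologicalSpace (SpecialLinearGroup ℂ (ℂ ⊗[ℚ] V)) :=
  TopologicalSpace.ofClosed
    {S | ∃ I : Set (MvPolynomial (V × Module.Dual ℚ V) k), S = zeroLocus I}
    ⟨{1}, by
      ext g
      simp [zeroLocus]⟩
    (by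
      intro A hA
      refine ⟨{p | ∃ I : Set (MvPolynomial (V × Module.Dual ℚ V) k),
        zeroLocus I ∈ A ∧ p ∈ I}, ?_⟩
      ext g
      constructor
      · rintro hg p ⟨I, hI, hp⟩
        exact hg _ hI p hp
      · intro hg S hS
        obtain ⟨I, rfl⟩ := hA hS
        exact fun p hp => hg p ⟨I, hS, hp⟩)
    (by
      rintro _ ⟨I, rfl⟩ _ ⟨J, rfl⟩
      refine ⟨{r | ∃ p ∈ I, ∃ q ∈ J, r = p * q}, ?_⟩
      ext g
      constructor
      · rintro (hg | hg) r ⟨p, hp, q, hq, rfl⟩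
        · rw [map_mul, hg p hp, zero_mul]
        · rw [map_mul, hg q hq, mul_zero]
      · intro hg
        by_contra hcon
        rw [Set.mem_union, not_or] at hcon
        obtain ⟨h1, h2⟩ := hcon
        simp only [zeroLocus, Set.mem_ofPred_eq, not_forall] at h1 h2
        obtain ⟨p, hp, hp'⟩ := h1
        obtain ⟨q, hq, hq'⟩ := h2
        have h := hg (p * q) ⟨p, hp, q, hq, rfl⟩
        rw [map_mul] at h
        exact (mul_eq_zero.mp h).elim hp' hq')

/-- Zariski closed subgroups of `SL(V ⊗ ℂ)`, i.e. complex linear algebraic groups. -/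
def IsAlgebraic (H : Subgroup (SpecialLinearGroup ℂ (ℂ ⊗[ℚ] V))) : Prop :=
  @IsClosed _ (zariski V ℂ) (H : Set (SpecialLinearGroup ℂ (ℂ ⊗[ℚ] V)))

/-- Linear algebraic groups defined over `ℚ`. -/
def IsQGroup (H : Subgroup (SpecialLinearGroup ℂ (ℂ ⊗[ℚ] V))) : Prop :=
  @IsClosed _ (zariski V ℚ) (H : Set (SpecialLinearGroup ℂ (ℂ ⊗[ℚ] V)))

/-- Connectedness as a complex algebraic group, i.e. in the Zariski topology over `ℂ`. -/
def IsZariskiConnected (H : Subgroup (SpecialLinearGroup ℂ (ℂ ⊗[ℚ] V))) : Prop :=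
  @IsConnected _ (zariski V ℂ) (H : Set (SpecialLinearGroup ℂ (ℂ ⊗[ℚ] V)))

/-- A Borel subgroup of `G`: a maximal connected solvable algebraic subgroup. -/
def IsBorel (G B : Subgroup (SpecialLinearGroup ℂ (ℂ ⊗[ℚ] V))) : Prop :=
  Maximal (fun B' => B' ≤ G ∧ IsAlgebraic B' ∧ IsZariskiConnected B' ∧ Group.IsSolvable B') B

/-- A parabolic `ℚ`-subgroup of `G`: an algebraic subgroup of `G` defined over `ℚ` which, over the
algebraically closed field `ℂ`, contains a Borel subgroup of `G`. -/
def IsParabolicQSubgroup (G P : Subgroup (SpecialLinearGroup ℂ (ℂ ⊗[ℚ] V))) : Prop :=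
  P ≤ G ∧ IsQGroup P ∧ ∃ B, IsBorel G B ∧ B ≤ P

/-- A semisimple `ℚ`-group: a connected linear algebraic `ℚ`-group without nontrivial connected
solvable normal algebraic subgroups over `ℂ`. -/
def IsSemisimpleQGroup (H : Subgroup (SpecialLinearGroup ℂ (ℂ ⊗[ℚ] V))) : Prop :=
  IsQGroup H ∧ IsZariskiConnected H ∧
    ∀ N : Subgroup (SpecialLinearGroup ℂ (ℂ ⊗[ℚ] V)), N ≤ H → (N.subgroupOf H).Normal →
      IsAlgebraic N → IsZariskiConnected N → Group.IsSolvable N → N = ⊥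

/-- The real points of a `ℚ`-group `H`: the elements of `SL(V ⊗ ℝ)` at which every polynomial
with rational coefficients vanishing on `H` vanishes. -/
def realPoints (H : Subgroup (SpecialLinearGroup ℂ (ℂ ⊗[ℚ] V))) :
    Set (SpecialLinearGroup ℝ (ℝ ⊗[ℚ] V)) :=
  {g | ∀ p : MvPolynomial (V × Module.Dual ℚ V) ℚ,
    (∀ h ∈ H, MvPolynomial.aeval (matrixCoeff h) p = 0) →
      MvPolynomial.aeval (matrixCoeff g) p = 0}

/-- The algebraic group `SO(V, q)`. -/
abbrev SO (q : QuadraticForm ℚ V) : Subgroup (SpecialLinearGroup ℂ (ℂ ⊗[ℚ] V)) :=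
  specialOrthogonal (q.baseChange ℂ)

/-- The algebraic group `SO(V', q')` of a quadratic subspace `V'` of `V`, as a subgroup of
`SO(V, q)`: the isometries of `V'` are extended by the identity on the orthogonal complement
of `V'`. -/
abbrev subSO (q : QuadraticForm ℚ V) (V' : Submodule ℚ V) :
    Subgroup (SpecialLinearGroup ℂ (ℂ ⊗[ℚ] V)) :=
  pointwiseStabilizer (q.baseChange ℂ) ((fun w : V => (1 : ℂ) ⊗ₜ[ℚ] w) '' perp q V')

/-- The real Lie group `G(ℝ) = SO(V ⊗ ℝ)`. -/
abbrev realSO (q : QuadraticForm ℚ V) : Subgroup (SpecialLinearGroup ℝ (ℝ ⊗[ℚ] V)) :=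
  specialOrthogonal (q.baseChange ℝ)

/-! ### Orthogonal Shimura varieties -/

variable (V) in
/-- The Euclidean topology on `SL(V ⊗ ℝ)`, induced from the space of endomorphisms. -/
abbrev euclidean : TopologicalSpace (SpecialLinearGroup ℝ (ℝ ⊗[ℚ] V)) :=
  TopologicalSpace.induced (fun g => (g.val : (ℝ ⊗[ℚ] V) →ₗ[ℝ] (ℝ ⊗[ℚ] V)))
    (moduleTopology ℝ ((ℝ ⊗[ℚ] V) →ₗ[ℝ] (ℝ ⊗[ℚ] V)))

/-- The connected component of the identity of `G(ℝ)` in the Euclidean topology. -/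
def realSOPlus (q : QuadraticForm ℚ V) : Set (SpecialLinearGroup ℝ (ℝ ⊗[ℚ] V)) :=
  @connectedComponentIn _ (euclidean V) (realSO q : Set (SpecialLinearGroup ℝ (ℝ ⊗[ℚ] V))) 1

/-- `K` is a maximal compact subgroup of `G(ℝ)`. -/
def IsMaximalCompact (q : QuadraticForm ℚ V)
    (K : Subgroup (SpecialLinearGroup ℝ (ℝ ⊗[ℚ] V))) : Prop :=
  Maximal (fun K' => K' ≤ realSO q ∧
    @IsCompact _ (euclidean V) (K' : Set (SpecialLinearGroup ℝ (ℝ ⊗[ℚ] V)))) K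

/-- The isometries in `SO(V, q)(ℚ)` which map the lattice `Λ` onto itself. -/
def latticeStabilizer (q : QuadraticForm ℚ V) (Λ : Submodule ℤ V) :
    Subgroup (SpecialLinearGroup ℚ V) where
  carrier := {g | g ∈ specialOrthogonal q ∧ ∀ x, g x ∈ Λ ↔ x ∈ Λ}
  one_mem' := ⟨(specialOrthogonal q).one_mem, fun _ => Iff.rfl⟩
  mul_mem' := by
    rintro a b ⟨ha, ha'⟩ ⟨hb, hb'⟩
    exact ⟨(specialOrthogonal q).mul_mem ha hb, fun x => (ha' (b x)).trans (hb' x)⟩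
  inv_mem' := by
    rintro a ⟨ha, ha'⟩
    refine ⟨(specialOrthogonal q).inv_mem ha, fun x => ?_⟩
    have e : a ((a⁻¹ : SpecialLinearGroup ℚ V) x) = x := a.val.apply_symm_apply x
    rw [← ha' ((a⁻¹ : SpecialLinearGroup ℚ V) x), e]

variable [FiniteDimensional ℚ V]

/-- An arithmetic subgroup of `G(ℚ)`: a subgroup of `G(ℚ) ∩ G(ℝ)⁺` commensurable with
`G(ℤ)`, the stabilizer in `G(ℚ)` of a full lattice in `V`. -/
def IsArithmetic (q : QuadraticForm ℚ V) (Γ : Subgroup (SpecialLinearGroup ℚ V)) : Prop :=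
  Γ ≤ specialOrthogonal q ∧
    (∀ γ ∈ Γ, SpecialLinearGroup.baseChange (S := ℝ) γ ∈ realSOPlus q) ∧
    ∃ Λ : Submodule ℤ V, Λ.FG ∧ Submodule.span ℚ (Λ : Set V) = ⊤ ∧
      Subgroup.Commensurable Γ (latticeStabilizer q Λ)

/-- The image of `Γ ⊆ G(ℚ)` in `G(ℝ)`. -/
def realImage (q : QuadraticForm ℚ V) (Γ : Subgroup (SpecialLinearGroup ℚ V)) :
    Subgroup (realSO q) :=
  (Γ.map (SpecialLinearGroup.baseChange (S := ℝ))).subgroupOf (realSO q)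

/-- The double quotient `X = Γ \ G(ℝ) / K`. -/
abbrev ShimuraVariety (q : QuadraticForm ℚ V) (Γ : Subgroup (SpecialLinearGroup ℚ V))
    (K : Subgroup (SpecialLinearGroup ℝ (ℝ ⊗[ℚ] V))) : Type _ :=
  DoubleCoset.Quotient (realImage q Γ : Set (realSO q))
    (K.subgroupOf (realSO q) : Set (realSO q))

/-! ### Special subvarieties -/

/-- The subset `H(ℝ) g K` of `G(ℝ)`, the preimage of the orbit of the point `gK` of the Hermitian
symmetric domain `G(ℝ) / K` under `H(ℝ)`. -/
def orbit (q : QuadraticForm ℚ V) (K : Subgroup (SpecialLinearGroup ℝ (ℝ ⊗[ℚ] V)))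
    (H : Subgroup (SpecialLinearGroup ℂ (ℂ ⊗[ℚ] V))) (g : realSO q) : Set (realSO q) :=
  {a | ∃ h k : realSO q, h.val ∈ realPoints H ∧ k.val ∈ K ∧ a = h * g * k}

/-- `y` is the negative definite plane in `V ⊗ ℝ` attached to the point `aK` of `G(ℝ) / K`, under
the identification of `G(ℝ) / K` with the Grassmannian of negative definite planes: it is the
one which is stable under the stabilizer `a K a⁻¹` of that point. -/
def IsPlaneOf (q : QuadraticForm ℚ V) (K : Subgroup (SpecialLinearGroup ℝ (ℝ ⊗[ℚ] V)))
    (a : realSO q) (y : Submodule ℝ (ℝ ⊗[ℚ] V)) : Prop :=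
  Module.finrank ℝ y = 2 ∧ (∀ v ∈ y, v ≠ 0 → q.baseChange ℝ v < 0) ∧
    ∀ k ∈ K, ∀ v ∈ y, (a.val * k * a.val⁻¹ : SpecialLinearGroup ℝ (ℝ ⊗[ℚ] V)) v ∈ y

/-- The orbit `H(ℝ) g K / K` is a Hermitian symmetric subdomain of `G(ℝ) / K`.

At a point of `G(ℝ) / K` with negative definite plane `y`, the rotations of `y`, extended by the
identity on the orthogonal complement of `y`, form a circle which fixes the point and acts on the
tangent space by multiplication with the complex numbers of modulus one; the rotation by `π`
is the geodesic symmetry. A Hermitian symmetric subdomain, i.e. a totally geodesic complex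
submanifold, is an orbit which is stable under these circles at each of its points. -/
def IsHermitianOrbit (q : QuadraticForm ℚ V) (K : Subgroup (SpecialLinearGroup ℝ (ℝ ⊗[ℚ] V)))
    (H : Subgroup (SpecialLinearGroup ℂ (ℂ ⊗[ℚ] V))) (g : realSO q) : Prop :=
  ∀ a ∈ orbit q K H g, ∀ y : Submodule ℝ (ℝ ⊗[ℚ] V), IsPlaneOf q K a y →
    ∀ u : realSO q, (∀ w ∈ perp (q.baseChange ℝ) (y : Set (ℝ ⊗[ℚ] V)), u.val w = w) →
      ∀ b ∈ orbit q K H g, u * b ∈ orbit q K H g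

/-- `Z` is a special subvariety of `X = Γ \ G(ℝ) / K` which arises from the algebraic
`ℚ`-subgroup `H` of `G = SO(V, q)`: for some base point `gK`, the orbit of `gK` under `H(ℝ)` is a
Hermitian symmetric subdomain of `G(ℝ) / K`, and `Z` is the image of this orbit in `X`. -/
def ArisesFrom (q : QuadraticForm ℚ V) (Γ : Subgroup (SpecialLinearGroup ℚ V))
    (K : Subgroup (SpecialLinearGroup ℝ (ℝ ⊗[ℚ] V))) (Z : Set (ShimuraVariety q Γ K))
    (H : Subgroup (SpecialLinearGroup ℂ (ℂ ⊗[ℚ] V))) : Prop :=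
  H ≤ SO q ∧ IsQGroup H ∧ ∃ g : realSO q, IsHermitianOrbit q K H g ∧
    Z = (fun a => (Quotient.mk _ a : ShimuraVariety q Γ K)) '' orbit q K H g

/-- Orthogonal Shimura subvarieties: special subvarieties arising from `SO(V', q')`, for a rational
quadratic subspace `V'` of signature `(r, 2)` with `r ≥ 1`. -/
def IsOrthogonalSubvariety (q : QuadraticForm ℚ V) (Γ : Subgroup (SpecialLinearGroup ℚ V))
    (K : Subgroup (SpecialLinearGroup ℝ (ℝ ⊗[ℚ] V))) (Z : Set (ShimuraVariety q Γ K)) : Prop :=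
  ∃ (V' : Submodule ℚ V) (r : ℕ), 1 ≤ r ∧ HasSignature (q.restrict V') r 2 ∧
    ArisesFrom q Γ K Z (subSO q V')

/-- `H` is semisimple and is not contained in any proper parabolic `ℚ`-subgroup of `SO(V, q)`. -/
def IsStronglySpecialGroup (q : QuadraticForm ℚ V)
    (H : Subgroup (SpecialLinearGroup ℂ (ℂ ⊗[ℚ] V))) : Prop :=
  IsSemisimpleQGroup H ∧
    ∀ P : Subgroup (SpecialLinearGroup ℂ (ℂ ⊗[ℚ] V)),
      IsParabolicQSubgroup (SO q) P → P ≠ SO q → ¬ H ≤ P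

/-- Strongly special subvarieties: special subvarieties which arise from a semisimple
`ℚ`-subgroup not contained in any proper parabolic `ℚ`-subgroup of `SO(V, q)`. -/
def IsStronglySpecial (q : QuadraticForm ℚ V) (Γ : Subgroup (SpecialLinearGroup ℚ V))
    (K : Subgroup (SpecialLinearGroup ℝ (ℝ ⊗[ℚ] V))) (Z : Set (ShimuraVariety q Γ K)) : Prop :=
  ∃ H : Subgroup (SpecialLinearGroup ℂ (ℂ ⊗[ℚ] V)),
    ArisesFrom q Γ K Z H ∧ IsStronglySpecialGroup q H

end OrthogonalShimura

end

open OrthogonalShimura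

/-!
The proof works with the complexified space `V ⊗ ℂ` and with Eichler transformations
`E(e, v)`, the unipotent isometries attached to an isotropic vector `e` and a vector `v`
orthogonal to it. Let `W = V' ⊗ ℂ`, a nondegenerate space of dimension at least three.

* The transformations `E(e, v)` and `E(f, v)` with `v ∈ W`, for a hyperbolic pair `e`, `f` of `W`,
  generate `SO(W)` (`mem_of_containsEichler`). They are transitive on vectors of length one, which
  yields all products of two reflections, and a weak form of the Cartan–Dieudonné theorem
  applies (`mem_of_reflections_mem`). As `t ↦ E(e, t • v)` is a polynomial curve, `SO(W)` is
  connected (`isZariskiConnected_subSO`). It acts irreducibly on `W`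
  (`le_or_orthogonal_of_eichler_stable`).

* Semisimplicity: a connected solvable normal subgroup `N` has a common eigenvector in `W`, by the
  Lie–Kolchin theorem (`exists_eigenvector_of_isSolvable`). Its weight space is stable under the
  connected group `SO(W)`, hence is all of `W`. So `N` acts on `W` by scalars, which are `1` or `-1`
  since `N` consists of isometries, and are `1` since `N` is connected.

* Parabolic subgroups: let `P` be a `ℚ`-subgroup containing `SO(W)` and a Borel subgroup `B`. By
  Lie–Kolchin, `B` preserves an isotropic line, spanned by `e` say. Since `B` and the
  transformations `E(e, v)` generate a connected solvable group, these lie in `B` by maximality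
  (`IsBorel.eichler_mem`). Consider the set `I` of all isotropic `e` such that `P` contains every
  `E(e, v)`. It is stable under `P`, and under complex conjugation because `P` is defined over `ℚ`.
  If two elements of `I` are not orthogonal, then `P` is all of `SO(V)` by the generation result.
  Otherwise `I` spans a totally isotropic space stable under `SO(W)`, which is orthogonal to `W` by
  irreducibility. The orthogonal complement of `V'` is positive definite, because `V` and `V'` have
  the same number of negative squares (`HasSignature.pos_of_orthogonal`). So a nonzero `e ∈ I` and
  its complex conjugate, which is again in `I`, cannot be orthogonal: a contradiction.
-/

noncomputable section

namespace OrthogonalShimura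

open QuadraticMap Module

/-! ### Eichler transformations and reflections -/

section Quadratic

variable {K M : Type*} [Field K] [AddCommGroup M] [Module K M] (Q : QuadraticForm K M)

/-- The Eichler transformation (or Siegel transvection) attached to `e` and `v`. It is an isometry
if `e` is isotropic and `v` is orthogonal to `e`. -/
def eichlerMap (e v x : M) : M :=
  x + polar Q e x • v - (polar Q v x + Q v * polar Q e x) • e

/-- The Eichler transformation as an element of the special linear group: a product of three
transvections. -/
def eichler {e v : M} (he : Q e = 0) (hv : polar Q e v = 0) : SpecialLinearGroup K M :=
  ⟨LinearEquiv.transvection (f := Q v • Q.polarBilin e) (v := e) (show (Q v • Q.polarBilin e) e = 0 by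
      simp [polar_self, he]) *
    LinearEquiv.transvection (f := -Q.polarBilin v) (v := e) (show (-Q.polarBilin v) e = 0 by
      simp [polar_comm Q v e, hv]) *
    LinearEquiv.transvection (f := Q.polarBilin e) (v := v) (show Q.polarBilin e v = 0 by
      simpa using hv),
    by simp [map_mul]⟩

variable {Q}

theorem eichler_apply {e v : M} (he : Q e = 0) (hv : polar Q e v = 0) (x : M) :
    (eichler Q he hv).val x = eichlerMap Q e v x := by
  simp only [eichler, LinearEquiv.mul_apply, LinearEquiv.transvection.apply, eichlerMap, LinearMap.neg_apply, LinearMap.smul_apply,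
    polarBilin_apply_apply, polar_add_right, polar_smul_right, polar_self, he, hv, smul_eq_mul,
    polar_neg_right, neg_smul]
  module

theorem map_eichlerMap {e v : M} (he : Q e = 0) (hv : polar Q e v = 0) (x : M) :
    Q (eichlerMap Q e v x) = Q x := by
  have h : eichlerMap Q e v x = x + polar Q e x • v + (-(polar Q v x + Q v * polar Q e x)) • e := by
    simp only [eichlerMap]; module
  rw [h]
  simp only [QuadraticMap.map_add Q, QuadraticMap.map_smul, polar_add_left, polar_smul_left,
    polar_smul_right, smul_eq_mul, he, polar_comm Q v e, hv, polar_comm Q x e, polar_comm Q x v]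
  ring

theorem eichler_mem {e v : M} (he : Q e = 0) (hv : polar Q e v = 0) :
    eichler Q he hv ∈ specialOrthogonal Q := fun x => by
  change Q ((eichler Q he hv).val x) = _
  rw [eichler_apply, map_eichlerMap he hv]

theorem eichlerMap_neg_eichlerMap {e v : M} (he : Q e = 0) (hv : polar Q e v = 0) (x : M) :
    eichlerMap Q e (-v) (eichlerMap Q e v x) = x := by
  simp only [eichlerMap, polar_add_right, polar_sub_right, polar_neg_left, polar_smul_right,
    polar_self, he, hv, polar_comm Q v e, smul_eq_mul, QuadraticMap.map_neg, nsmul_eq_mul]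
  module

theorem eichlerMap_add {e v w : M} (he : Q e = 0) (hv : polar Q e v = 0) (hw : polar Q e w = 0)
    (x : M) : eichlerMap Q e v (eichlerMap Q e w x) = eichlerMap Q e (v + w) x := by
  simp only [eichlerMap, polar_add_right, polar_sub_right, polar_add_left, polar_smul_right,
    polar_self, he, hv, hw, polar_comm Q v e, smul_eq_mul, QuadraticMap.map_add Q, nsmul_eq_mul]
  module

theorem eichlerMap_smul_left (c : K) (e v x : M) :
    eichlerMap Q (c • e) v x = eichlerMap Q e (c • v) x := by
  simp only [eichlerMap, polar_smul_left, smul_eq_mul, QuadraticMap.map_smul]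
  module

/-- Isometries transport Eichler transformations. -/
theorem eichlerMap_conj {g : M →ₗ[K] M} (hg : ∀ x, Q (g x) = Q x) (e v x : M) :
    g (eichlerMap Q e v x) = eichlerMap Q (g e) (g v) (g x) := by
  have hp (x y : M) : polar Q (g x) (g y) = polar Q x y := by
    simp only [polar, ← map_add, hg]
  simp only [eichlerMap, hp, hg, map_add, map_sub, map_smul]

theorem polar_map_eq {g : SpecialLinearGroup K M} (hg : g ∈ specialOrthogonal Q) (x y : M) :
    polar Q (g.val x) (g.val y) = polar Q x y := by
  have h (x : M) : Q (g.val x) = Q x := hg x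
  simp only [polar, ← map_add, h]

theorem eichlerMap_of_orthogonal {e v x : M} (he : polar Q e x = 0) (hv : polar Q v x = 0) :
    eichlerMap Q e v x = x := by
  simp [eichlerMap, he, hv]

variable (Q) in
/-- The reflection in the hyperplane orthogonal to `u`, for anisotropic `u`. -/
def reflection (u : M) : M →ₗ[K] M :=
  LinearMap.transvection (Q.polarBilin u) (-(Q u)⁻¹ • u)

theorem reflection_apply (u x : M) :
    reflection Q u x = x - (polar Q u x * (Q u)⁻¹) • u := by
  simp only [reflection, LinearMap.transvection.apply, polarBilin_apply_apply]
  module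

theorem map_reflection (u x : M) : Q (reflection Q u x) = Q x := by
  by_cases hu : Q u = 0
  · simp [reflection_apply, hu]
  rw [reflection_apply, sub_eq_add_neg, ← neg_smul]
  simp only [QuadraticMap.map_add Q, QuadraticMap.map_smul, smul_eq_mul, polar_smul_right,
    polar_comm Q x u]
  field_simp
  ring

theorem reflection_self {u : M} (hu : Q u ≠ 0) : reflection Q u u = -u := by
  rw [reflection_apply, polar_self, nsmul_eq_mul, mul_assoc, mul_inv_cancel₀ hu]
  module

theorem reflection_reflection {u : M} (hu : Q u ≠ 0) (x : M) :
    reflection Q u (reflection Q u x) = x := by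
  conv_lhs => rw [reflection_apply u x]
  rw [map_sub, map_smul, reflection_self hu, reflection_apply]
  module

theorem reflection_of_orthogonal {u x : M} (h : polar Q u x = 0) : reflection Q u x = x := by
  simp [reflection_apply, h]

theorem reflection_smul {c : K} (hc : c ≠ 0) (u x : M) :
    reflection Q (c • u) x = reflection Q u x := by
  simp only [reflection_apply, polar_smul_left, QuadraticMap.map_smul, smul_eq_mul, mul_inv,
    smul_smul]
  congr 2
  field_simp

/-- Isometries transport reflections. -/
theorem reflection_conj {g : M →ₗ[K] M} (hg : ∀ x, Q (g x) = Q x) (u x : M) :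
    g (reflection Q u x) = reflection Q (g u) (g x) := by
  have hp (x y : M) : polar Q (g x) (g y) = polar Q x y := by
    simp only [polar, ← map_add, hg]
  simp only [reflection_apply, hp, hg, map_sub, map_smul]

theorem det_reflection [FiniteDimensional K M] {u : M} (hu : Q u ≠ 0) :
    LinearMap.det (reflection Q u) = -1 := by
  rw [reflection, LinearMap.transvection.det, polarBilin_apply_apply, polar_smul_right, polar_self,
    smul_eq_mul, nsmul_eq_mul]
  field_simp
  norm_num

/-- If `u` and `u'` have the same length and `u - u'` is anisotropic, the reflection in `u - u'`
exchanges them. -/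
theorem reflection_sub_apply {u u' : M} (h : Q u' = Q u) (hd : Q (u - u') ≠ 0) :
    reflection Q (u - u') u' = u := by
  have h1 : polar Q (u - u') u' = -Q (u - u') := by
    have : Q (u - u') = Q u + Q u' - polar Q u u' := by
      rw [sub_eq_add_neg, QuadraticMap.map_add Q, QuadraticMap.map_neg, polar_neg_right]; ring
    rw [this, polar_sub_left, polar_self, nsmul_eq_mul, h]; push_cast; ring
  rw [reflection_apply, h1, neg_mul, mul_inv_cancel₀ hd]
  module

/-! ### Generation of the special orthogonal group -/

variable (Q) in
/-- The quadratic form is nondegenerate on the subspace `W`. -/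
def NondegenerateOn (W : Submodule K M) : Prop :=
  ∀ x ∈ W, (∀ y ∈ W, polar Q y x = 0) → x = 0

theorem NondegenerateOn.exists_sub_orthogonal [FiniteDimensional K M] {W : Submodule K M}
    (hW : NondegenerateOn Q W) (x : M) : ∃ w ∈ W, ∀ y ∈ W, polar Q y (x - w) = 0 := by
  have hr : Q.polarBilin.IsRefl := fun a b h => by
    simpa [polar_comm Q b a] using h
  have hd : IsCompl W (LinearMap.BilinForm.orthogonal Q.polarBilin W) := by
    rw [LinearMap.BilinForm.isCompl_orthogonal_iff_disjoint hr, Submodule.disjoint_def]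
    intro x hx hx'
    refine hW x hx fun y hy => ?_
    exact hx' y hy
  obtain ⟨w, hw, z, hz, rfl⟩ := Submodule.mem_sup.1 (hd.sup_eq_top ▸ Submodule.mem_top (x := x))
  refine ⟨w, hw, fun y hy => ?_⟩
  rw [add_sub_cancel_left]
  exact hz y hy

theorem NondegenerateOn.exists_anisotropic {W : Submodule K M} (hW : NondegenerateOn Q W)
    (h0 : W ≠ ⊥) : ∃ u ∈ W, Q u ≠ 0 := by
  by_contra! h
  refine h0 ((Submodule.eq_bot_iff _).2 fun x hx => hW x hx fun y hy => ?_)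
  simp [polar, h _ hx, h _ hy, h _ (W.add_mem hy hx)]

variable (Q) in
/-- The subspace of `W` orthogonal to `u`. -/
def perpIn (W : Submodule K M) (u : M) : Submodule K M := W ⊓ LinearMap.ker (Q.polarBilin u)

theorem mem_perpIn {W : Submodule K M} {u x : M} : x ∈ perpIn Q W u ↔ x ∈ W ∧ polar Q u x = 0 := by
  simp [perpIn]

theorem finrank_le_perpIn [FiniteDimensional K M] (W : Submodule K M) (u : M) :
    finrank K W ≤ finrank K (perpIn Q W u) + 1 := by
  by_cases h : W ≤ LinearMap.ker (Q.polarBilin u)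
  · rw [perpIn, inf_eq_left.2 h]; omega
  obtain ⟨w, hw, hw'⟩ := SetLike.not_le_iff_exists.1 h
  have hw' : polar Q u w ≠ 0 := by simpa using hw'
  have hle : W ≤ perpIn Q W u ⊔ Submodule.span K {w} := fun x hx => by
    refine Submodule.mem_sup.2 ⟨x - (polar Q u x / polar Q u w) • w, mem_perpIn.2
      ⟨W.sub_mem hx (W.smul_mem _ hw), ?_⟩, _, Submodule.smul_mem _ (polar Q u x / polar Q u w)
        (Submodule.mem_span_singleton_self w), by module⟩
    rw [polar_sub_right, polar_smul_right, smul_eq_mul, div_mul_cancel₀ _ hw', sub_self]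
  calc finrank K W ≤ _ := Submodule.finrank_mono hle
    _ ≤ _ := Submodule.finrank_add_le_finrank_add_finrank _ _
    _ ≤ _ := Nat.add_le_add_left ((finrank_span_le_card _).trans (by simp)) _

/-- An isometry which fixes the orthogonal complement of `W` preserves `W`. -/
theorem NondegenerateOn.apply_mem [FiniteDimensional K M] {W : Submodule K M}
    (hW : NondegenerateOn Q W) (hM : NondegenerateOn Q ⊤) {g : SpecialLinearGroup K M}
    (hg : g ∈ specialOrthogonal Q) (hfix : ∀ x, (∀ y ∈ W, polar Q y x = 0) → g.val x = x)
    {u : M} (hu : u ∈ W) : g.val u ∈ W := by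
  obtain ⟨w, hw, hw'⟩ := hW.exists_sub_orthogonal (g.val u)
  have : g.val u - w = 0 := by
    refine hM _ trivial fun y _ => ?_
    obtain ⟨w₁, hw₁, hw₁'⟩ := hW.exists_sub_orthogonal y
    have e1 := polar_map_eq hg (y - w₁) u
    rw [hfix _ hw₁', polar_comm Q _ u, hw₁' u hu] at e1
    rw [← sub_add_cancel y w₁, polar_add_left, hw' _ hw₁, polar_sub_right, e1,
      polar_comm Q _ w, hw₁' w hw]
    simp
  rw [sub_eq_zero.1 this]; exact hw

section CharNeTwo

variable [NeZero (2 : K)]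

theorem NondegenerateOn.perpIn {W : Submodule K M} (hW : NondegenerateOn Q W) {u : M} (hu : u ∈ W)
    (hQ : Q u ≠ 0) : NondegenerateOn Q (perpIn Q W u) := fun x hx h => by
  rw [mem_perpIn] at hx
  refine hW x hx.1 fun y hy => ?_
  have h2 : polar Q u u ≠ 0 := by
    rw [polar_self, nsmul_eq_mul]; exact mul_ne_zero (NeZero.ne _) hQ
  have := h (y - (polar Q u y / polar Q u u) • u) (mem_perpIn.2
    ⟨W.sub_mem hy (W.smul_mem _ hu), by
      rw [polar_sub_right, polar_smul_right, smul_eq_mul, div_mul_cancel₀ _ h2, sub_self]⟩)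
  rwa [polar_sub_left, polar_smul_left, hx.2, smul_zero, sub_zero] at this

/-- A weak form of the Cartan–Dieudonné theorem, relative to a nondegenerate subspace `W`: a
subgroup containing the products of two reflections in vectors of `W` contains every
isometry of determinant one which is the identity on the orthogonal complement of `W`. -/
theorem mem_of_reflections_mem [FiniteDimensional K M] (hM : NondegenerateOn Q ⊤)
    {Ω : Subgroup (SpecialLinearGroup K M)} {W : Submodule K M} (hW : NondegenerateOn Q W)
    (hΩ : ∀ u ∈ W, ∀ v ∈ W, Q u ≠ 0 → Q v ≠ 0 →
      ∃ g ∈ Ω, ∀ x, g.val x = reflection Q u (reflection Q v x))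
    (g : SpecialLinearGroup K M) (hg : g ∈ specialOrthogonal Q)
    (hfix : ∀ x, (∀ y ∈ W, polar Q y x = 0) → g.val x = x) : g ∈ Ω := by
  induction hn : finrank K W using Nat.strong_induction_on generalizing W g with
  | _ n ih =>
  subst hn
  by_cases h0 : W = ⊥
  · have : g = 1 := by
      ext x
      exact hfix x fun y hy => by rw [h0, Submodule.mem_bot] at hy; simp [hy]
    rw [this]; exact Ω.one_mem
  obtain ⟨u, hu, hQu⟩ := hW.exists_anisotropic h0
  have h2 : polar Q u u ≠ 0 := by
    rw [polar_self, nsmul_eq_mul]; exact mul_ne_zero (NeZero.ne _) hQu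
  have hgu : g.val u ∈ W := hW.apply_mem hM hg hfix hu
  have hW2 := hW.perpIn hu hQu
  have hlt : finrank K (OrthogonalShimura.perpIn Q W u) < finrank K W :=
    Submodule.finrank_lt_finrank_of_lt <| lt_of_le_of_ne inf_le_left fun h => by
      have := h.symm ▸ hu
      exact h2 (mem_perpIn.1 this).2
  -- it suffices to modify `g` by elements of `Ω` so that it fixes `u`
  have key (h : SpecialLinearGroup K M) (hh : h ∈ specialOrthogonal Q)
      (hhfix : ∀ x, (∀ y ∈ W, polar Q y x = 0) → h.val x = x) (hhu : h.val u = u) : h ∈ Ω := by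
    refine ih _ hlt hW2 (fun u hu v hv => hΩ u hu.1 v hv.1) h hh (fun x hx => ?_) rfl
    have : h.val (x - (polar Q u x / polar Q u u) • u) = x - (polar Q u x / polar Q u u) • u := by
      refine hhfix _ fun y hy => ?_
      have e := hx (y - (polar Q u y / polar Q u u) • u) (mem_perpIn.2
        ⟨W.sub_mem hy (W.smul_mem _ hu), by
          rw [polar_sub_right, polar_smul_right, smul_eq_mul, div_mul_cancel₀ _ h2, sub_self]⟩)
      simp only [polar_sub_left, polar_smul_left, polar_sub_right, polar_smul_right,
        smul_eq_mul, polar_comm Q y u] at e ⊢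
      rw [← e]; field_simp
    rw [map_sub, map_smul, hhu] at this
    simpa using this
  -- the modification: a product of two reflections
  have key2 (a b : M) (ha : a ∈ W) (hb : b ∈ W) (hQa : Q a ≠ 0) (hQb : Q b ≠ 0)
      (hab : reflection Q a (reflection Q b (g.val u)) = u) : g ∈ Ω := by
    obtain ⟨h, hh, hh'⟩ := hΩ a ha b hb hQa hQb
    have hm : ∀ x, (h * g).val x = reflection Q a (reflection Q b (g.val x)) := fun x => hh' (g.val x)
    have : h * g ∈ Ω := key (h * g) (fun x => by
        change Q ((h * g).val x) = _
        rw [hm, map_reflection, map_reflection]; exact hg x)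
      (fun x hx => by
        rw [hm, hfix x hx, reflection_of_orthogonal (hx b hb), reflection_of_orthogonal (hx a ha)])
      (by rw [hm, hab])
    exact (Ω.mul_mem_cancel_left hh).1 this
  by_cases hd : Q (u - g.val u) = 0
  · have hs : Q (u + g.val u) ≠ 0 := by
      have e1 : Q (u + g.val u) + Q (u - g.val u) = 4 * Q u := by
        have := hg u
        rw [sub_eq_add_neg, QuadraticMap.map_add Q, QuadraticMap.map_add Q, QuadraticMap.map_neg,
          polar_neg_right, this]; ring
      rw [hd, add_zero] at e1
      have h4 : (4 : K) ≠ 0 := by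
        have : (4 : K) = 2 * 2 := by norm_num
        rw [this]; exact mul_ne_zero (NeZero.ne _) (NeZero.ne _)
      rw [e1]; exact mul_ne_zero h4 hQu
    refine key2 u (u + g.val u) hu (W.add_mem hu hgu) hQu hs ?_
    have e : reflection Q (u + g.val u) (g.val u) = -u := by
      have := reflection_sub_apply (Q := Q) (u := u) (u' := -g.val u)
        (by rw [QuadraticMap.map_neg]; exact hg u) (by simpa using hs)
      rw [sub_neg_eq_add, map_neg] at this
      exact neg_eq_iff_eq_neg.1 this
    rw [e, map_neg, reflection_self hQu, neg_neg]
  · by_cases h1 : OrthogonalShimura.perpIn Q W u = ⊥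
    · -- if `W` is a line, then `g` would be a reflection, contradicting `det g = 1`
      exfalso
      have hgr : (g.val : M →ₗ[K] M) = reflection Q (u - g.val u) := by
        ext x
        obtain ⟨w, hw, hw'⟩ := hW.exists_sub_orthogonal x
        have hwu : w = (polar Q u w / polar Q u u) • u := by
          have hm : w - (polar Q u w / polar Q u u) • u ∈ OrthogonalShimura.perpIn Q W u :=
            mem_perpIn.2 ⟨W.sub_mem hw (W.smul_mem _ hu), by
              rw [polar_sub_right, polar_smul_right, smul_eq_mul, div_mul_cancel₀ _ h2, sub_self]⟩
          rw [h1, Submodule.mem_bot] at hm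
          exact sub_eq_zero.1 hm
        have e1 : g.val (x - w) = x - w := hfix _ hw'
        have e2 : reflection Q (u - g.val u) (x - w) = x - w :=
          reflection_of_orthogonal (hw' _ (W.sub_mem hu hgu))
        have e3 : reflection Q (u - g.val u) u = g.val u := by
          have := reflection_reflection hd (g.val u)
          rwa [reflection_sub_apply (hg u) hd] at this
        have e4 : g.val w = reflection Q (u - g.val u) w := by
          rw [hwu, map_smul, map_smul, e3]
        change g.val x = _
        rw [← sub_add_cancel x w, map_add, map_add, e1, e2, e4]
      have hdet := SpecialLinearGroup.det_eq_one g
      rw [hgr, det_reflection hd] at hdet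
      have : (2 : K) = 0 := by linear_combination -hdet
      exact NeZero.ne _ this
    · obtain ⟨w, hw, hQw⟩ := hW2.exists_anisotropic h1
      rw [mem_perpIn] at hw
      refine key2 w (u - g.val u) hw.1 (W.sub_mem hu hgu) hQw hd ?_
      rw [reflection_sub_apply (hg u) hd, reflection_of_orthogonal]
      rw [polar_comm, hw.2]

end CharNeTwo

end Quadratic

/-! ### Hyperbolic triples -/

section Triple

variable {K M : Type*} [Field K] [AddCommGroup M] [Module K M] {Q : QuadraticForm K M}

variable (Q) in
/-- A hyperbolic pair `e`, `f` in `W`, together with a vector `a` of `W` of length one which is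
orthogonal to both. -/
structure IsHyperbolicTriple (W : Submodule K M) (e f a : M) : Prop where
  mem_e : e ∈ W
  mem_f : f ∈ W
  mem_a : a ∈ W
  map_e : Q e = 0
  map_f : Q f = 0
  map_a : Q a = 1
  polar_ef : polar Q e f = 1
  polar_ea : polar Q e a = 0
  polar_fa : polar Q f a = 0

theorem IsHyperbolicTriple.swap {W : Submodule K M} {e f a : M} (h : IsHyperbolicTriple Q W e f a) :
    IsHyperbolicTriple Q W f e a :=
  ⟨h.mem_f, h.mem_e, h.mem_a, h.map_f, h.map_e, h.map_a, by rw [polar_comm, h.polar_ef],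
    h.polar_fa, h.polar_ea⟩

variable (Q) in
/-- The group `Ω` contains all Eichler transformations attached to `e` and a vector of `W`. -/
def ContainsEichler (Ω : Subgroup (SpecialLinearGroup K M)) (W : Submodule K M) (e : M) : Prop :=
  ∀ v ∈ W, polar Q e v = 0 → ∃ g ∈ Ω, ∀ x, g.val x = eichlerMap Q e v x

/-- Whether the product of the reflections in `a` and `u` lies in `Ω` depends only on the orbit of
`u` under Eichler transformations in `Ω`, since the reflection in `a` normalizes their set. -/
theorem exists_reflection_mul_reflection_of_eichlerMap {Ω : Subgroup (SpecialLinearGroup K M)}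
    {W : Submodule K M} {e a : M} (ha : a ∈ W) (he0 : Q e = 0) (hea : polar Q e a = 0)
    (he : ContainsEichler Q Ω W e) {v : M} (hv : v ∈ W) (hev : polar Q e v = 0) {u : M}
    (H : ∃ g ∈ Ω, ∀ x, g.val x = reflection Q a (reflection Q (eichlerMap Q e v u) x)) :
    ∃ g ∈ Ω, ∀ x, g.val x = reflection Q a (reflection Q u x) := by
  obtain ⟨g, hg, hgx⟩ := H
  have hnv : polar Q e (-v) = 0 := by rw [polar_neg_right, hev, neg_zero]
  have hrv : reflection Q a (-v) ∈ W := by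
    rw [reflection_apply]; exact W.sub_mem (W.neg_mem hv) (W.smul_mem _ ha)
  have hre : reflection Q a e = e := reflection_of_orthogonal (by rw [polar_comm, hea])
  have hrev : polar Q e (reflection Q a (-v)) = 0 := by
    rw [reflection_apply, polar_sub_right, polar_smul_right, hea, smul_zero, hnv, sub_zero]
  obtain ⟨g₁, hg₁, hg₁x⟩ := he v hv hev
  obtain ⟨g₂, hg₂, hg₂x⟩ := he _ hrv hrev
  refine ⟨g₂ * g * g₁, Ω.mul_mem (Ω.mul_mem hg₂ hg) hg₁, fun x => ?_⟩
  change g₂.val (g.val (g₁.val x)) = _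
  have hE : ∀ y, eichlerMap Q e v (reflection Q u y) =
      reflection Q (eichlerMap Q e v u) (eichlerMap Q e v y) := fun y => by
    have := reflection_conj (Q := Q) (g := ((eichler Q he0 hev).val : M →ₗ[K] M))
      (fun x => eichler_mem he0 hev x) u y
    simpa [eichler_apply] using this
  have hR : ∀ y, reflection Q a (eichlerMap Q e (-v) y) =
      eichlerMap Q e (reflection Q a (-v)) (reflection Q a y) := fun y => by
    rw [eichlerMap_conj (g := reflection Q a) (map_reflection a), hre]
  rw [hg₁x, hgx, hg₂x, ← hE, ← hR, eichlerMap_neg_eichlerMap he0 hev]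

/-- A hyperbolic pair in a nondegenerate space of dimension at least three extends to a hyperbolic
triple. -/
theorem exists_isHyperbolicTriple_of_pair [IsAlgClosed K] [FiniteDimensional K M]
    {W : Submodule K M} (hW : NondegenerateOn Q W) (h3 : 3 ≤ finrank K W) {e f : M} (he : e ∈ W)
    (hf : f ∈ W) (hQe : Q e = 0) (hQf : Q f = 0) (hef : polar Q e f = 1) :
    ∃ a, IsHyperbolicTriple Q W e f a := by
  have hfe : polar Q f e = 1 := by rw [polar_comm, hef]
  set U := perpIn Q (perpIn Q W e) f with hU
  have hmem {x : M} : x ∈ U ↔ (x ∈ W ∧ polar Q e x = 0) ∧ polar Q f x = 0 := by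
    rw [hU, mem_perpIn, mem_perpIn]
  have hU0 : U ≠ ⊥ := by
    intro h0
    have h1 := finrank_le_perpIn (Q := Q) W e
    have h2 := finrank_le_perpIn (Q := Q) (perpIn Q W e) f
    rw [← hU, h0, finrank_bot] at h2
    omega
  have hUn : NondegenerateOn Q U := fun x hx hxy => by
    rw [hmem] at hx
    refine hW x hx.1.1 fun y hy => ?_
    have := hxy (y - polar Q f y • e - polar Q e y • f) (hmem.2 ⟨⟨W.sub_mem (W.sub_mem hy
      (W.smul_mem _ he)) (W.smul_mem _ hf), by simp [polar_sub_right, polar_self, hQe, hef]⟩,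
      by simp [polar_sub_right, polar_self, hQf, hfe]⟩)
    simpa [polar_sub_left, hx.1.2, hx.2] using this
  obtain ⟨u, hu, hQu⟩ := hUn.exists_anisotropic hU0
  obtain ⟨c, hc⟩ := IsAlgClosed.exists_pow_nat_eq (Q u)⁻¹ two_pos
  rw [hmem] at hu
  exact ⟨c • u, he, hf, W.smul_mem c hu.1.1, hQe, hQf,
    by rw [QuadraticMap.map_smul, ← pow_two, hc, smul_eq_mul, inv_mul_cancel₀ hQu], hef,
    by rw [polar_smul_right, hu.1.2, smul_zero], by rw [polar_smul_right, hu.2, smul_zero]⟩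

section CharNeTwo

variable [NeZero (2 : K)]

/-- A vector `x` of length one with nonzero coefficient at `f` is moved to a vector `β • f + a` by
an Eichler transformation attached to `e`, and from there to `a` by one attached to `f`. -/
theorem exists_reflection_mul_reflection_of_polar_ne_zero
    {Ω : Subgroup (SpecialLinearGroup K M)} {W : Submodule K M}
    {e f a : M} (h : IsHyperbolicTriple Q W e f a) (he : ContainsEichler Q Ω W e)
    (hf : ContainsEichler Q Ω W f) {x : M} (hx : x ∈ W) (hQx : Q x = 1) (hβ : polar Q e x ≠ 0) :
    ∃ g ∈ Ω, ∀ y, g.val y = reflection Q a (reflection Q x y) := by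
  have hQa : Q a ≠ 0 := by rw [h.map_a]; exact one_ne_zero
  have haf : polar Q a f = 0 := by rw [polar_comm, h.polar_fa]
  have h2 : (2 : K) ≠ 0 := NeZero.ne _
  set β := polar Q e x with hβ'
  set α := polar Q f x with hα'
  set z := x - α • e - β • f with hz'
  have hz : z ∈ W := W.sub_mem (W.sub_mem hx (W.smul_mem _ h.mem_e)) (W.smul_mem _ h.mem_f)
  have hez : polar Q e z = 0 := by
    simp [hz', polar_sub_right, polar_self, h.map_e, h.polar_ef, ← hβ']
  have hev : polar Q e (β⁻¹ • (a - z)) = 0 := by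
    rw [polar_smul_right, polar_sub_right, h.polar_ea, hez, sub_zero, smul_zero]
  refine exists_reflection_mul_reflection_of_eichlerMap h.mem_a h.map_e h.polar_ea he
    (v := β⁻¹ • (a - z)) (W.smul_mem _ (W.sub_mem h.mem_a hz)) hev ?_
  obtain ⟨c, hc⟩ : ∃ c, eichlerMap Q e (β⁻¹ • (a - z)) x = c • e + (β • f + a) := by
    refine ⟨α - (polar Q (β⁻¹ • (a - z)) x + Q (β⁻¹ • (a - z)) * β), ?_⟩
    rw [eichlerMap, ← hβ', smul_smul, mul_inv_cancel₀ hβ, hz']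
    module
  -- the length determines the coefficient of `e`
  have hc0 : c = 0 := by
    have := map_eichlerMap h.map_e hev x
    rw [hc, hQx] at this
    simp only [QuadraticMap.map_add Q, QuadraticMap.map_smul, polar_add_right, polar_smul_left,
      polar_smul_right, h.map_e, h.map_f, h.map_a, h.polar_ea, h.polar_fa, h.polar_ef,
      smul_eq_mul] at this
    have : c * β = 0 := by linear_combination this
    exact (mul_eq_zero.1 this).resolve_right hβ
  rw [hc, hc0, zero_smul, zero_add]
  refine exists_reflection_mul_reflection_of_eichlerMap h.mem_a h.map_f h.polar_fa hf
    (v := (β / 2) • a) (W.smul_mem _ h.mem_a)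
    (by rw [polar_smul_right, h.polar_fa, smul_zero]) ⟨1, Ω.one_mem, fun x => ?_⟩
  have : eichlerMap Q f ((β / 2) • a) (β • f + a) = a := by
    simp only [eichlerMap, polar_add_right, polar_smul_right, polar_smul_left, polar_self,
      h.map_f, h.polar_fa, haf, h.map_a, smul_eq_mul, nsmul_eq_mul, Nat.cast_ofNat]
    rw [show β / 2 * (2 * 1) = β by field_simp]
    module
  rw [this, reflection_reflection hQa]; rfl

/-- A chain of Eichler transformations moves every vector of length one in `W` to `a`. -/
theorem exists_reflection_mul_reflection_of_map_eq_one
    {Ω : Subgroup (SpecialLinearGroup K M)} {W : Submodule K M}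
    {e f a : M} (h : IsHyperbolicTriple Q W e f a) (he : ContainsEichler Q Ω W e)
    (hf : ContainsEichler Q Ω W f) {u : M} (hu : u ∈ W) (hQu : Q u = 1) :
    ∃ g ∈ Ω, ∀ x, g.val x = reflection Q a (reflection Q u x) := by
  by_cases hβ : polar Q e u = 0
  · by_cases hα : polar Q f u = 0
    · refine exists_reflection_mul_reflection_of_eichlerMap h.mem_a h.map_f h.polar_fa hf hu hα
        (exists_reflection_mul_reflection_of_polar_ne_zero h he hf ?_ ?_ ?_)
      · exact W.sub_mem (W.add_mem hu (W.smul_mem _ hu)) (W.smul_mem _ h.mem_f)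
      · rw [map_eichlerMap h.map_f hα, hQu]
      · simp only [eichlerMap, hα, hβ, polar_sub_right, polar_smul_right, polar_self, hQu,
          polar_add_right, h.polar_ef, smul_eq_mul, nsmul_eq_mul, Nat.cast_ofNat]
        simpa using NeZero.ne (2 : K)
    · exact exists_reflection_mul_reflection_of_polar_ne_zero h.swap hf he hu hQu hα
  · exact exists_reflection_mul_reflection_of_polar_ne_zero h he hf hu hQu hβ

/-- Over an algebraically closed field, the Eichler transformations of `W` attached to a hyperbolic
pair generate the special orthogonal group of `W`. -/
theorem mem_of_containsEichler [IsAlgClosed K] [FiniteDimensional K M]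
    (hM : NondegenerateOn Q ⊤) {Ω : Subgroup (SpecialLinearGroup K M)} {W : Submodule K M}
    (hW : NondegenerateOn Q W) {e f a : M} (h : IsHyperbolicTriple Q W e f a)
    (he : ContainsEichler Q Ω W e) (hf : ContainsEichler Q Ω W f)
    (g : SpecialLinearGroup K M) (hg : g ∈ specialOrthogonal Q)
    (hfix : ∀ x, (∀ y ∈ W, polar Q y x = 0) → g.val x = x) : g ∈ Ω := by
  have hQa : Q a ≠ 0 := by rw [h.map_a]; exact one_ne_zero
  have key (u : M) (hu : u ∈ W) (hQu : Q u ≠ 0) :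
      ∃ g ∈ Ω, ∀ x, g.val x = reflection Q a (reflection Q u x) := by
    obtain ⟨c, hc⟩ := IsAlgClosed.exists_pow_nat_eq (Q u)⁻¹ two_pos
    have hc0 : c ≠ 0 := by rintro rfl; exact inv_ne_zero hQu (by rw [← hc]; simp)
    obtain ⟨g, hg, hgx⟩ := exists_reflection_mul_reflection_of_map_eq_one h he hf
      (W.smul_mem c hu)
      (by rw [QuadraticMap.map_smul, ← pow_two, hc, smul_eq_mul, inv_mul_cancel₀ hQu])
    exact ⟨g, hg, fun x => by rw [hgx, reflection_smul hc0]⟩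
  refine mem_of_reflections_mem hM hW (fun u hu v hv hQu hQv => ?_) g hg hfix
  obtain ⟨g₁, hg₁, hg₁x⟩ := key u hu hQu
  obtain ⟨g₂, hg₂, hg₂x⟩ := key v hv hQv
  refine ⟨g₁⁻¹ * g₂, Ω.mul_mem (Ω.inv_mem hg₁) hg₂, fun x => ?_⟩
  change g₁.val.symm (g₂.val x) = _
  rw [LinearEquiv.symm_apply_eq, hg₂x, hg₁x, reflection_reflection hQu]

/-! ### Existence of hyperbolic triples and irreducibility -/

theorem exists_isHyperbolicTriple [IsAlgClosed K] [FiniteDimensional K M]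
    {W : Submodule K M} (hW : NondegenerateOn Q W) (h3 : 3 ≤ finrank K W) :
    ∃ e f a, IsHyperbolicTriple Q W e f a := by
  have hone {U : Submodule K M} (hU : NondegenerateOn Q U) (h1 : 1 ≤ finrank K U) :
      ∃ u ∈ U, Q u = 1 := by
    obtain ⟨u, hu, hQu⟩ := hU.exists_anisotropic (by rintro rfl; simp at h1)
    obtain ⟨c, hc⟩ := IsAlgClosed.exists_pow_nat_eq (Q u)⁻¹ two_pos
    exact ⟨c • u, U.smul_mem c hu,
      by rw [QuadraticMap.map_smul, ← pow_two, hc, smul_eq_mul, inv_mul_cancel₀ hQu]⟩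
  obtain ⟨u, hu, hQu⟩ := hone hW (by omega)
  obtain ⟨v, hv, hQv⟩ := hone (hW.perpIn hu (by rw [hQu]; exact one_ne_zero))
    (by have := finrank_le_perpIn (Q := Q) W u; omega)
  obtain ⟨i, hi⟩ := IsAlgClosed.exists_pow_nat_eq (-1 : K) two_pos
  rw [mem_perpIn] at hv
  have h2 : (2 : K) ≠ 0 := NeZero.ne _
  have hvu : polar Q v u = 0 := by rw [polar_comm, hv.2]
  have he : Q (u + i • v) = 0 := by
    simp only [QuadraticMap.map_add Q, QuadraticMap.map_smul, polar_smul_right, hQu, hQv, hv.2,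
      smul_eq_mul]
    linear_combination hi
  have hf : Q (u - i • v) = 0 := by
    rw [sub_eq_add_neg, ← smul_neg]
    simp only [QuadraticMap.map_add Q, QuadraticMap.map_smul, QuadraticMap.map_neg,
      polar_smul_right, polar_neg_right, hQu, hQv, hv.2, smul_eq_mul]
    linear_combination hi
  obtain ⟨a, ha⟩ := exists_isHyperbolicTriple_of_pair hW h3 (e := u + i • v)
    (f := (1 / 4 : K) • (u - i • v))
    (W.add_mem hu (W.smul_mem _ hv.1)) (W.smul_mem _ (W.sub_mem hu (W.smul_mem _ hv.1)))
    he (by rw [QuadraticMap.map_smul, hf, smul_zero]) (by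
      have h4 : (4 : K) ≠ 0 := by
        rw [show (4 : K) = 2 * 2 by norm_num]; exact mul_ne_zero h2 h2
      simp only [polar_smul_right, polar_sub_right, polar_add_left, polar_smul_left, polar_self,
        hQu, hQv, hv.2, hvu, smul_eq_mul, nsmul_eq_mul, Nat.cast_ofNat]
      field_simp
      linear_combination (-2) * hi)
  exact ⟨_, _, a, ha⟩

/-- A subspace stable under the Eichler transformations attached to a hyperbolic pair of `W`
contains `W` or is orthogonal to `W`. -/
theorem le_or_orthogonal_of_eichler_stable {W U : Submodule K M} {e f a : M}
    (h : IsHyperbolicTriple Q W e f a)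
    (hU : ∀ v ∈ W, polar Q e v = 0 → ∀ x ∈ U, eichlerMap Q e v x ∈ U)
    (hU' : ∀ v ∈ W, polar Q f v = 0 → ∀ x ∈ U, eichlerMap Q f v x ∈ U) :
    W ≤ U ∨ ∀ x ∈ U, ∀ y ∈ W, polar Q y x = 0 := by
  have h2 : (2 : K) ≠ 0 := NeZero.ne _
  -- `U` contains the orthogonal complement of `e` in `W` unless it is orthogonal to `e`
  have key {e a : M} (ha : a ∈ W) (he : Q e = 0) (hQa : Q a = 1) (hea : polar Q e a = 0)
      (hU : ∀ v ∈ W, polar Q e v = 0 → ∀ x ∈ U, eichlerMap Q e v x ∈ U) {x : M} (hx : x ∈ U)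
      (hex : polar Q e x ≠ 0) : e ∈ U ∧ ∀ v ∈ W, polar Q e v = 0 → v ∈ U := by
    have hsum (v : M) (hv : v ∈ W) (hev : polar Q e v = 0) : (Q v * polar Q e x) • e ∈ U := by
      have h₁ := U.sub_mem (hU v hv hev x hx) hx
      have h₂ := U.sub_mem (hU (-v) (W.neg_mem hv) (by rw [polar_neg_right, hev, neg_zero]) x hx) hx
      have := U.smul_mem (-(2 : K)⁻¹) (U.add_mem h₁ h₂)
      convert this using 1
      simp only [eichlerMap, polar_neg_left, QuadraticMap.map_neg]
      match_scalars <;> field_simp <;> ring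
    have heU : e ∈ U := by
      have := hsum a ha hea
      rw [hQa, one_mul] at this
      exact (U.smul_mem_iff hex).1 this
    refine ⟨heU, fun v hv hev => ?_⟩
    have h₁ := U.sub_mem (hU v hv hev x hx) hx
    refine (U.smul_mem_iff hex).1 ?_
    convert U.add_mem h₁ (U.smul_mem (polar Q v x + Q v * polar Q e x) heU) using 1
    simp only [eichlerMap]
    module
  have hfe : polar Q f e = 1 := h.swap.polar_ef
  have hef : polar Q e f = 1 := h.polar_ef
  have keyE {x : M} := @key e a h.mem_a h.map_e h.map_a h.polar_ea hU x
  have keyF {x : M} := @key f a h.mem_a h.map_f h.map_a h.polar_fa hU' x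
  -- the complements of `e` and of `f` span `W`
  have fin (hE : ∀ v ∈ W, polar Q e v = 0 → v ∈ U) (hF : ∀ v ∈ W, polar Q f v = 0 → v ∈ U) :
      W ≤ U := fun y hy => by
    rw [← sub_add_cancel y (polar Q e y • f)]
    refine U.add_mem (hE _ (W.sub_mem hy (W.smul_mem _ h.mem_f)) ?_)
      (U.smul_mem _ (hF f h.mem_f ?_))
    · rw [polar_sub_right, polar_smul_right, hef, smul_eq_mul, mul_one, sub_self]
    · rw [polar_self, h.map_f, smul_zero]
  have viaE {x : M} (hx : x ∈ U) (hex : polar Q e x ≠ 0) : W ≤ U := by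
    obtain ⟨heU, hE⟩ := keyE hx hex
    exact fin hE (keyF heU (by rw [hfe]; exact one_ne_zero)).2
  have viaF {x : M} (hx : x ∈ U) (hfx : polar Q f x ≠ 0) : W ≤ U := by
    obtain ⟨hfU, hF⟩ := keyF hx hfx
    exact fin (keyE hfU (by rw [hef]; exact one_ne_zero)).2 hF
  by_contra! hcon
  obtain ⟨hWU, x, hx, y, hy, hyx⟩ := hcon
  have hex : polar Q e x = 0 := by by_contra h; exact hWU (viaE hx h)
  have hfx : polar Q f x = 0 := by by_contra h; exact hWU (viaF hx h)
  set z := y - polar Q f y • e - polar Q e y • f with hz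
  have hzW : z ∈ W := W.sub_mem (W.sub_mem hy (W.smul_mem _ h.mem_e)) (W.smul_mem _ h.mem_f)
  have hez : polar Q e z = 0 := by simp [hz, polar_sub_right, polar_self, h.map_e, hef]
  have hzx : polar Q z x = polar Q y x := by simp [hz, polar_sub_left, hex, hfx]
  refine hWU (viaF (hU z hzW hez x hx) ?_)
  simp only [eichlerMap, hex, zero_smul, add_zero, mul_zero, polar_sub_right, polar_smul_right,
    hfx, hfe, hzx]
  simpa using hyx

end CharNeTwo

end Triple

/-! ### Regular functions and the Zariski topology -/

section Zariski

variable {V : Type*} [AddCommGroup V] [Module ℚ V]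

variable (V) in
/-- The algebra of regular functions on `SL(V ⊗ ℂ)`, generated by the matrix coefficients. -/
def regularFunctions : Subalgebra ℂ (SpecialLinearGroup ℂ (ℂ ⊗[ℚ] V) → ℂ) :=
  (MvPolynomial.aeval (R := ℂ) (fun (i : V × Module.Dual ℚ V)
    (g : SpecialLinearGroup ℂ (ℂ ⊗[ℚ] V)) => matrixCoeff g i)).range

theorem aeval_matrixCoeff_apply (p : MvPolynomial (V × Module.Dual ℚ V) ℂ)
    (g : SpecialLinearGroup ℂ (ℂ ⊗[ℚ] V)) :
    MvPolynomial.aeval (R := ℂ) (fun (i : V × Module.Dual ℚ V)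
      (g : SpecialLinearGroup ℂ (ℂ ⊗[ℚ] V)) => matrixCoeff g i) p g =
      MvPolynomial.aeval (matrixCoeff g) p := by
  induction p using MvPolynomial.induction_on with
  | C a => simp
  | add p q hp hq => simp [hp, hq]
  | mul_X p i hp => simp [hp]

theorem mem_regularFunctions_iff {f : SpecialLinearGroup ℂ (ℂ ⊗[ℚ] V) → ℂ} :
    f ∈ regularFunctions V ↔ ∃ p : MvPolynomial (V × Module.Dual ℚ V) ℂ,
      ∀ g, f g = MvPolynomial.aeval (matrixCoeff g) p := by
  refine exists_congr fun p => ⟨?_, fun h => ?_⟩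
  · rintro rfl g; exact aeval_matrixCoeff_apply p g
  · ext g; rw [h g]; exact aeval_matrixCoeff_apply p g

theorem matrixCoeff_mem (i : V × Module.Dual ℚ V) :
    (fun g => matrixCoeff g i) ∈ regularFunctions V :=
  ⟨MvPolynomial.X i, by simp⟩

local instance zariskiTopology : TopologicalSpace (SpecialLinearGroup ℂ (ℂ ⊗[ℚ] V)) := zariski V ℂ

theorem isClosed_iff_zeroLocus (k : Type*) [Field k] [Algebra k ℂ]
    {S : Set (SpecialLinearGroup ℂ (ℂ ⊗[ℚ] V))} :
    @IsClosed _ (zariski V k) S ↔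
      ∃ I : Set (MvPolynomial (V × Module.Dual ℚ V) k), S = zeroLocus I := by
  rw [← @isOpen_compl_iff _ _ (zariski V k)]
  change Sᶜᶜ ∈ _ ↔ _
  rw [compl_compl]; rfl

theorem isClosed_iff_regular {S : Set (SpecialLinearGroup ℂ (ℂ ⊗[ℚ] V))} :
    IsClosed S ↔ ∃ T ⊆ (regularFunctions V : Set (SpecialLinearGroup ℂ (ℂ ⊗[ℚ] V) → ℂ)),
      S = {g | ∀ f ∈ T, f g = 0} := by
  refine (isClosed_iff_zeroLocus ℂ).trans ⟨?_, ?_⟩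
  · rintro ⟨I, rfl⟩
    refine ⟨(fun p g => MvPolynomial.aeval (matrixCoeff g) p) '' I, ?_, ?_⟩
    · rintro _ ⟨p, -, rfl⟩; exact mem_regularFunctions_iff.2 ⟨p, fun _ => rfl⟩
    · ext g
      simp [zeroLocus]
  · rintro ⟨T, hT, rfl⟩
    refine ⟨{p | (fun g => MvPolynomial.aeval (matrixCoeff g) p) ∈ T}, ?_⟩
    ext g
    constructor
    · intro h p hp
      exact h _ hp
    · intro h f hf
      obtain ⟨p, hp⟩ := mem_regularFunctions_iff.1 (hT hf)
      rw [hp]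
      refine h p (show (fun g => MvPolynomial.aeval (matrixCoeff g) p) ∈ T from ?_)
      rwa [← funext hp]

theorem isClosed_eq_zero {f : SpecialLinearGroup ℂ (ℂ ⊗[ℚ] V) → ℂ} (hf : f ∈ regularFunctions V) :
    IsClosed {g | f g = 0} :=
  isClosed_iff_regular.2 ⟨{f}, by simpa using hf, by simp⟩

/-- A map is continuous for the Zariski topology if its composites with the matrix coefficients are
regular. -/
theorem continuous_of_regular
    {φ : SpecialLinearGroup ℂ (ℂ ⊗[ℚ] V) → SpecialLinearGroup ℂ (ℂ ⊗[ℚ] V)}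
    (hφ : ∀ i, (fun g => matrixCoeff (φ g) i) ∈ regularFunctions V) : Continuous φ := by
  rw [continuous_iff_isClosed]
  intro S hS
  obtain ⟨T, hT, rfl⟩ := isClosed_iff_regular.1 hS
  have key : ∀ f ∈ regularFunctions V, f ∘ φ ∈ regularFunctions V := by
    intro f hf
    obtain ⟨p, hp⟩ := mem_regularFunctions_iff.1 hf
    simp only [Function.comp_def, hp]
    clear hp
    induction p using MvPolynomial.induction_on with
    | C a =>
      simp only [MvPolynomial.aeval_C]
      exact (regularFunctions V).algebraMap_mem a
    | add p q hp hq =>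
      simp only [map_add]
      exact (regularFunctions V).add_mem hp hq
    | mul_X p i hp =>
      simp only [map_mul, MvPolynomial.aeval_X]
      exact (regularFunctions V).mul_mem hp (hφ i)
  exact isClosed_iff_regular.2 ⟨(· ∘ φ) '' T, by rintro _ ⟨f, hf, rfl⟩; exact key f (hT hf),
    by ext g; simp⟩

/-- The image of a polynomial curve is connected. -/
theorem isPreconnected_range_of_polynomial {γ : ℂ → SpecialLinearGroup ℂ (ℂ ⊗[ℚ] V)}
    (hγ : ∀ i, ∃ p : Polynomial ℂ, ∀ t, matrixCoeff (γ t) i = p.eval t) :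
    IsPreconnected (Set.range γ) := by
  have key : ∀ f ∈ regularFunctions V, ∃ p : Polynomial ℂ, ∀ t, f (γ t) = p.eval t := by
    intro f hf
    obtain ⟨p, hp⟩ := mem_regularFunctions_iff.1 hf
    simp only [hp]
    clear hp
    induction p using MvPolynomial.induction_on with
    | C a => exact ⟨Polynomial.C a, by simp⟩
    | add p q hp hq =>
      obtain ⟨P, hP⟩ := hp
      obtain ⟨R, hR⟩ := hq
      exact ⟨P + R, fun t => by rw [map_add, hP, hR, Polynomial.eval_add]⟩
    | mul_X p i hp =>
      obtain ⟨P, hP⟩ := hp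
      obtain ⟨R, hR⟩ := hγ i
      exact ⟨P * R, fun t => by
        rw [map_mul, hP, MvPolynomial.aeval_X, hR, Polynomial.eval_mul]⟩
  rw [isPreconnected_closed_iff]
  intro S S' hS hS' hsub hne hne'
  obtain ⟨T, hT, rfl⟩ := isClosed_iff_regular.1 hS
  obtain ⟨T', hT', rfl⟩ := isClosed_iff_regular.1 hS'
  by_contra hcon
  -- otherwise there are regular functions which do not vanish on the curve, but whose product does
  have h1 : ∃ f ∈ T, ∃ t, f (γ t) ≠ 0 := by
    by_contra! h
    obtain ⟨_, ⟨t, rfl⟩, ht⟩ := hne'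
    exact hcon ⟨_, ⟨t, rfl⟩, fun f hf => h f hf t, ht⟩
  have h2 : ∃ f ∈ T', ∃ t, f (γ t) ≠ 0 := by
    by_contra! h
    obtain ⟨_, ⟨t, rfl⟩, ht⟩ := hne
    exact hcon ⟨_, ⟨t, rfl⟩, ht, fun f hf => h f hf t⟩
  obtain ⟨f, hf, t, hft⟩ := h1
  obtain ⟨f', hf', t', hft'⟩ := h2
  obtain ⟨p, hp⟩ := key f (hT hf)
  obtain ⟨p', hp'⟩ := key f' (hT' hf')
  have hpp : p * p' = 0 := by
    refine Polynomial.funext fun s => ?_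
    rw [Polynomial.eval_mul, ← hp, ← hp', Polynomial.eval_zero]
    rcases hsub ⟨s, rfl⟩ with h | h
    · rw [h f hf, zero_mul]
    · rw [h f' hf', mul_zero]
  rcases mul_eq_zero.1 hpp with h | h
  · exact hft (by rw [hp, h, Polynomial.eval_zero])
  · exact hft' (by rw [hp', h, Polynomial.eval_zero])

theorem apply_one_tmul {ι : Type*} [Fintype ι] (b : Basis ι ℚ V)
    (g : SpecialLinearGroup ℂ (ℂ ⊗[ℚ] V)) (v : V) :
    g.val ((1 : ℂ) ⊗ₜ[ℚ] v) = ∑ i, matrixCoeff g (v, b.coord i) ⊗ₜ[ℚ] b i := by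
  rw [← (b.baseChange ℂ).sum_repr (g.val ((1 : ℂ) ⊗ₜ[ℚ] v))]
  refine Finset.sum_congr rfl fun i _ => ?_
  have h3 : (b.baseChange ℂ).repr (g.val ((1 : ℂ) ⊗ₜ[ℚ] v)) i = matrixCoeff g (v, b.coord i) := by
    change ((b.baseChange ℂ).coord i) _ = Module.Dual.baseChange ℂ (b.coord i) _
    congr 1
    refine (b.baseChange ℂ).ext fun j => ?_
    classical simp [Finsupp.single_apply]
  rw [h3, Basis.baseChange_apply, TensorProduct.smul_tmul', smul_eq_mul, mul_one]

variable [FiniteDimensional ℚ V]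

theorem regular_dual_apply (φ : Module.Dual ℂ (ℂ ⊗[ℚ] V)) (x : ℂ ⊗[ℚ] V) :
    (fun g : SpecialLinearGroup ℂ (ℂ ⊗[ℚ] V) => φ (g.val x)) ∈ regularFunctions V := by
  let b := Module.finBasis ℚ V
  induction x with
  | zero =>
    simp only [map_zero]
    exact (regularFunctions V).zero_mem
  | add x y hx hy =>
    simp only [map_add]
    exact (regularFunctions V).add_mem hx hy
  | tmul c v =>
    have : (fun g : SpecialLinearGroup ℂ (ℂ ⊗[ℚ] V) => φ (g.val (c ⊗ₜ[ℚ] v))) =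
        ∑ i, (c * φ ((b.baseChange ℂ) i)) • fun g => matrixCoeff g (v, b.coord i) := by
      ext g
      have h1 : c ⊗ₜ[ℚ] v = c • ((1 : ℂ) ⊗ₜ[ℚ] v) := by rw [TensorProduct.smul_tmul']; simp
      rw [h1, map_smul, map_smul, apply_one_tmul b, map_sum, Finset.sum_apply, smul_eq_mul,
        Finset.mul_sum]
      refine Finset.sum_congr rfl fun i _ => ?_
      have h2 : matrixCoeff g (v, b.coord i) ⊗ₜ[ℚ] b i =
          matrixCoeff g (v, b.coord i) • (b.baseChange ℂ) i := by
        rw [Basis.baseChange_apply, TensorProduct.smul_tmul', smul_eq_mul, mul_one]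
      rw [h2, map_smul, Pi.smul_apply, smul_eq_mul, smul_eq_mul]
      ring
    rw [this]
    exact (regularFunctions V).sum_mem fun i _ =>
      (regularFunctions V).smul_mem (matrixCoeff_mem _) _

/-- Inversion is regular, since the inverse of a matrix of determinant one is its adjugate. -/
theorem regular_dual_inv_apply (φ : Module.Dual ℂ (ℂ ⊗[ℚ] V)) (x : ℂ ⊗[ℚ] V) :
    (fun g : SpecialLinearGroup ℂ (ℂ ⊗[ℚ] V) => φ ((g⁻¹).val x)) ∈ regularFunctions V := by
  let b := Module.finBasis ℂ (ℂ ⊗[ℚ] V)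
  -- the generic matrix, with entries in the algebra of regular functions
  let A : Matrix (Fin _) (Fin _) (regularFunctions V) := fun i j =>
    ⟨fun g => b.coord i (g.val (b j)), regular_dual_apply _ _⟩
  have hA (g : SpecialLinearGroup ℂ (ℂ ⊗[ℚ] V)) (i j) :
      b.coord i ((g⁻¹).val (b j)) = (A.adjugate i j).val g := by
    let ev : regularFunctions V →+* ℂ :=
      (Pi.evalRingHom (fun _ => ℂ) g).comp (regularFunctions V).val.toRingHom
    have h1 : ev.mapMatrix A = LinearMap.toMatrix b b (g.val : (ℂ ⊗[ℚ] V) →ₗ[ℂ] (ℂ ⊗[ℚ] V)) := by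
      ext i j; rw [LinearMap.toMatrix_apply]; rfl
    have h2 : (ev.mapMatrix A).adjugate =
        LinearMap.toMatrix b b ((g⁻¹).val : (ℂ ⊗[ℚ] V) →ₗ[ℂ] (ℂ ⊗[ℚ] V)) := by
      have hd : (ev.mapMatrix A).det = 1 := by
        rw [h1, LinearMap.det_toMatrix]; exact SpecialLinearGroup.det_eq_one g
      have hm : ev.mapMatrix A *
          LinearMap.toMatrix b b ((g⁻¹).val : (ℂ ⊗[ℚ] V) →ₗ[ℂ] (ℂ ⊗[ℚ] V)) = 1 := by
        rw [h1, ← LinearMap.toMatrix_comp b b b, ← LinearMap.toMatrix_id b]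
        congr 1
        refine LinearMap.ext fun x => ?_
        exact g.val.apply_symm_apply x
      calc _ = (ev.mapMatrix A).adjugate * (ev.mapMatrix A * _) := by rw [hm, mul_one]
        _ = _ := by rw [← mul_assoc, Matrix.adjugate_mul, hd, one_smul, one_mul]
    have h3 := congrFun₂ (ev.map_adjugate A) i j
    rw [h2, LinearMap.toMatrix_apply] at h3
    exact h3.symm
  have : (fun g : SpecialLinearGroup ℂ (ℂ ⊗[ℚ] V) => φ ((g⁻¹).val x)) =
      ∑ j, ∑ i, (b.repr x j * φ (b i)) • (A.adjugate i j).val := by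
    ext g
    conv_lhs => rw [← b.sum_repr x]
    simp only [map_sum, map_smul, Finset.sum_apply]
    refine Finset.sum_congr rfl fun j _ => ?_
    conv_lhs => rw [← b.sum_repr ((g⁻¹).val (b j))]
    simp only [map_sum, map_smul, smul_eq_mul, Finset.mul_sum, Pi.smul_apply]
    refine Finset.sum_congr rfl fun i _ => ?_
    rw [← hA g i j, Basis.coord_apply]
    ring
  rw [this]
  exact (regularFunctions V).sum_mem fun j _ => (regularFunctions V).sum_mem fun i _ =>
      (regularFunctions V).smul_mem (A.adjugate i j).2 _

/-- Composites of regular families of endomorphisms are regular. -/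
theorem regular_comp {α β : SpecialLinearGroup ℂ (ℂ ⊗[ℚ] V) → (ℂ ⊗[ℚ] V) →ₗ[ℂ] (ℂ ⊗[ℚ] V)}
    (hα : ∀ (φ : Module.Dual ℂ (ℂ ⊗[ℚ] V)) x, (fun g => φ (α g x)) ∈ regularFunctions V)
    (hβ : ∀ (φ : Module.Dual ℂ (ℂ ⊗[ℚ] V)) x, (fun g => φ (β g x)) ∈ regularFunctions V)
    (φ : Module.Dual ℂ (ℂ ⊗[ℚ] V)) (x : ℂ ⊗[ℚ] V) :
    (fun g => φ (α g (β g x))) ∈ regularFunctions V := by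
  let b := Module.finBasis ℂ (ℂ ⊗[ℚ] V)
  have : (fun g => φ (α g (β g x))) =
      ∑ i, (fun g => b.coord i (β g x)) * fun g => φ (α g (b i)) := by
    ext g
    conv_lhs => rw [← b.sum_repr (β g x)]
    simp only [map_sum, map_smul, smul_eq_mul, Finset.sum_apply, Pi.mul_apply, Basis.coord_apply]
  rw [this]
  exact (regularFunctions V).sum_mem fun i _ => (regularFunctions V).mul_mem (hβ _ _) (hα _ _)

theorem continuous_mul_left_zariski (h : SpecialLinearGroup ℂ (ℂ ⊗[ℚ] V)) :
    Continuous fun g => h * g :=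
  continuous_of_regular fun i => regular_dual_apply
    ((Module.Dual.baseChange ℂ i.2).comp (h.val : (ℂ ⊗[ℚ] V) →ₗ[ℂ] (ℂ ⊗[ℚ] V))) _

theorem continuous_mul_right_zariski (h : SpecialLinearGroup ℂ (ℂ ⊗[ℚ] V)) :
    Continuous fun g => g * h :=
  continuous_of_regular fun i => regular_dual_apply (Module.Dual.baseChange ℂ i.2) (h.val _)

theorem continuous_inv_zariski :
    Continuous fun g : SpecialLinearGroup ℂ (ℂ ⊗[ℚ] V) => g⁻¹ :=
  continuous_of_regular fun _ => regular_dual_inv_apply _ _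

open scoped commutatorElement in
theorem continuous_commutator_left (h : SpecialLinearGroup ℂ (ℂ ⊗[ℚ] V)) :
    Continuous fun g : SpecialLinearGroup ℂ (ℂ ⊗[ℚ] V) => ⁅g, h⁆ := by
  refine continuous_of_regular fun i => ?_
  have := regular_comp (V := V) (α := fun g => g.val)
    (β := fun g => (h.val : (ℂ ⊗[ℚ] V) →ₗ[ℂ] (ℂ ⊗[ℚ] V)).comp
      ((g⁻¹).val : (ℂ ⊗[ℚ] V) →ₗ[ℂ] (ℂ ⊗[ℚ] V)))
    (fun φ x => regular_dual_apply φ x)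
    (fun φ x => regular_dual_inv_apply (φ.comp (h.val : (ℂ ⊗[ℚ] V) →ₗ[ℂ] (ℂ ⊗[ℚ] V))) x)
    (Module.Dual.baseChange ℂ i.2) ((h⁻¹).val ((1 : ℂ) ⊗ₜ[ℚ] i.1))
  exact this

open scoped commutatorElement in
theorem continuous_commutator_right (h : SpecialLinearGroup ℂ (ℂ ⊗[ℚ] V)) :
    Continuous fun g : SpecialLinearGroup ℂ (ℂ ⊗[ℚ] V) => ⁅h, g⁆ := by
  have : (fun g : SpecialLinearGroup ℂ (ℂ ⊗[ℚ] V) => ⁅h, g⁆) = fun g => (⁅g, h⁆)⁻¹ := by ext1 g; rw [commutatorElement_inv]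
  rw [this]
  exact continuous_inv_zariski.comp (continuous_commutator_left h)

end Zariski

section LieKolchin

variable {V : Type*} [AddCommGroup V] [Module ℚ V] [FiniteDimensional ℚ V]

attribute [local instance] zariskiTopology

/-! ### Connected groups and closures -/

/-- A group generated by elements which can be joined to `1` within the group is connected. -/
theorem isConnected_of_closure {G : Subgroup (SpecialLinearGroup ℂ (ℂ ⊗[ℚ] V))}
    {S : Set (SpecialLinearGroup ℂ (ℂ ⊗[ℚ] V))} (hG : G ≤ Subgroup.closure S)
    (hS : ∀ s ∈ S, ∃ C ⊆ (G : Set (SpecialLinearGroup ℂ (ℂ ⊗[ℚ] V))), IsPreconnected C ∧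
      1 ∈ C ∧ s ∈ C) :
    IsZariskiConnected G := by
  have htrans (h : SpecialLinearGroup ℂ (ℂ ⊗[ℚ] V)) {C : Set (SpecialLinearGroup ℂ (ℂ ⊗[ℚ] V))}
      (hC : IsPreconnected C) : IsPreconnected ((fun g => h * g) '' C) :=
    hC.image _ (continuous_mul_left_zariski h).continuousOn
  have key : ∀ g ∈ Subgroup.closure S, g ∈ G ∧
      ∃ C ⊆ (G : Set (SpecialLinearGroup ℂ (ℂ ⊗[ℚ] V))), IsPreconnected C ∧ 1 ∈ C ∧ g ∈ C := by
    intro g hg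
    induction hg using Subgroup.closure_induction with
    | mem s hs =>
      obtain ⟨C, hC, h⟩ := hS s hs
      exact ⟨hC h.2.2, C, hC, h⟩
    | one =>
      exact ⟨G.one_mem, {1}, by simp, isPreconnected_singleton, rfl, rfl⟩
    | mul g h _ _ hg hh =>
      obtain ⟨hgG, C, hC, hCc, hC1, hgC⟩ := hg
      obtain ⟨hhG, D, hD, hDc, hD1, hhD⟩ := hh
      refine ⟨G.mul_mem hgG hhG, C ∪ (fun x => g * x) '' D, ?_, ?_, Or.inl hC1,
        Or.inr ⟨h, hhD, rfl⟩⟩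
      · refine Set.union_subset hC ?_
        rintro _ ⟨x, hx, rfl⟩
        exact G.mul_mem hgG (hD hx)
      · exact IsPreconnected.union g hgC ⟨1, hD1, mul_one g⟩ hCc (htrans g hDc)
    | inv g _ hg =>
      obtain ⟨hgG, C, hC, hCc, hC1, hgC⟩ := hg
      refine ⟨G.inv_mem hgG, (fun x => g⁻¹ * x) '' C, ?_, htrans _ hCc, ⟨g, hgC, inv_mul_cancel g⟩,
        ⟨1, hC1, mul_one _⟩⟩
      rintro _ ⟨x, hx, rfl⟩
      exact G.mul_mem (G.inv_mem hgG) (hC hx)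
  refine ⟨⟨1, G.one_mem⟩, isPreconnected_of_forall 1 fun g hg => ?_⟩
  obtain ⟨-, C, hC, hCc, hC1, hgC⟩ := key g (hG hg)
  exact ⟨C, hC, hC1, hgC, hCc⟩

open scoped commutatorElement in
theorem IsZariskiConnected.commutator {G : Subgroup (SpecialLinearGroup ℂ (ℂ ⊗[ℚ] V))}
    (hG : IsZariskiConnected G) : IsZariskiConnected ⁅G, G⁆ := by
  refine isConnected_of_closure (Subgroup.commutator_def G G).le ?_
  rintro _ ⟨g, hg, h, hh, rfl⟩
  refine ⟨(fun x => ⁅x, h⁆) '' G, ?_,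
    hG.isPreconnected.image _ (continuous_commutator_left h).continuousOn,
    ⟨1, G.one_mem, commutatorElement_one_left h⟩, ⟨g, hg, rfl⟩⟩
  rintro _ ⟨x, hx, rfl⟩
  exact Subgroup.commutator_mem_commutator hx hh

/-- The Zariski closure of a subgroup. -/
def zariskiClosure (G : Subgroup (SpecialLinearGroup ℂ (ℂ ⊗[ℚ] V))) :
    Subgroup (SpecialLinearGroup ℂ (ℂ ⊗[ℚ] V)) where
  carrier := closure G
  one_mem' := subset_closure G.one_mem
  mul_mem' := by
    have h1 : ∀ a ∈ G, ∀ b ∈ closure (G : Set (SpecialLinearGroup ℂ (ℂ ⊗[ℚ] V))),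
        a * b ∈ closure (G : Set (SpecialLinearGroup ℂ (ℂ ⊗[ℚ] V))) := fun a ha b hb =>
      map_mem_closure (continuous_mul_left_zariski a) hb fun x hx => G.mul_mem ha hx
    intro a b ha hb
    have := map_mem_closure (continuous_mul_right_zariski b) ha (t := closure G)
      fun x hx => h1 x hx b hb
    rwa [closure_closure] at this
  inv_mem' := fun {a} ha =>
    map_mem_closure continuous_inv_zariski ha fun x hx => G.inv_mem hx

theorem le_zariskiClosure (G : Subgroup (SpecialLinearGroup ℂ (ℂ ⊗[ℚ] V))) :
    G ≤ zariskiClosure G := subset_closure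

theorem zariskiClosure_le {G H : Subgroup (SpecialLinearGroup ℂ (ℂ ⊗[ℚ] V))} (h : G ≤ H)
    (hH : IsAlgebraic H) : zariskiClosure G ≤ H := closure_minimal h hH

theorem isAlgebraic_zariskiClosure (G : Subgroup (SpecialLinearGroup ℂ (ℂ ⊗[ℚ] V))) :
    IsAlgebraic (zariskiClosure G) := isClosed_closure

theorem IsZariskiConnected.zariskiClosure {G : Subgroup (SpecialLinearGroup ℂ (ℂ ⊗[ℚ] V))}
    (hG : IsZariskiConnected G) : IsZariskiConnected (zariskiClosure G) := IsConnected.closure hG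

open scoped commutatorElement in
theorem commutator_zariskiClosure_le (G : Subgroup (SpecialLinearGroup ℂ (ℂ ⊗[ℚ] V))) :
    ⁅zariskiClosure G, zariskiClosure G⁆ ≤ zariskiClosure ⁅G, G⁆ := by
  rw [Subgroup.commutator_le]
  have h1 : ∀ a ∈ G, ∀ b ∈ zariskiClosure G, ⁅a, b⁆ ∈ zariskiClosure ⁅G, G⁆ := fun a ha b hb =>
    map_mem_closure (continuous_commutator_right a) hb fun x hx =>
      Subgroup.commutator_mem_commutator ha hx
  intro a ha b hb
  have := map_mem_closure (continuous_commutator_left b) ha (t := zariskiClosure ⁅G, G⁆)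
    fun x hx => h1 x hx b hb
  change _ ∈ closure (closure _) at this
  rwa [closure_closure] at this

/-- The derived series of a subgroup, as a sequence of subgroups of the ambient group. -/
def derivedSubgroup {A : Type*} [Group A] (G : Subgroup A) : ℕ → Subgroup A
  | 0 => G
  | n + 1 => ⁅derivedSubgroup G n, derivedSubgroup G n⁆

theorem map_derivedSeries {A : Type*} [Group A] (G : Subgroup A) (n : ℕ) :
    (derivedSeries G n).map G.subtype = derivedSubgroup G n := by
  induction n with
  | zero => rw [derivedSeries_zero, ← MonoidHom.range_eq_map, Subgroup.range_subtype]; rfl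
  | succ n ih => rw [derivedSeries_succ, Subgroup.map_commutator, ih]; rfl

theorem isSolvable_iff_derivedSubgroup {A : Type*} [Group A] (G : Subgroup A) :
    Group.IsSolvable G ↔ ∃ n, derivedSubgroup G n = ⊥ := by
  rw [Group.isSolvable_def]
  refine exists_congr fun n => ?_
  rw [← map_derivedSeries, Subgroup.map_eq_bot_iff_of_injective _ G.subtype_injective]

theorem isSolvable_zariskiClosure {G : Subgroup (SpecialLinearGroup ℂ (ℂ ⊗[ℚ] V))}
    (hG : Group.IsSolvable G) : Group.IsSolvable (zariskiClosure G) := by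
  rw [isSolvable_iff_derivedSubgroup] at hG ⊢
  obtain ⟨n, hn⟩ := hG
  have key (n : ℕ) : derivedSubgroup (zariskiClosure G) n ≤ zariskiClosure (derivedSubgroup G n) := by
    induction n with
    | zero => exact le_rfl
    | succ n ih => exact (Subgroup.commutator_mono ih ih).trans (commutator_zariskiClosure_le _)
  refine ⟨n, le_bot_iff.1 ((key n).trans ?_)⟩
  rw [hn]
  refine zariskiClosure_le le_rfl ?_
  -- a point is closed, being cut out by its matrix entries
  have : ((⊥ : Subgroup (SpecialLinearGroup ℂ (ℂ ⊗[ℚ] V))) : Set (SpecialLinearGroup ℂ (ℂ ⊗[ℚ] V)))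
      = ⋂ (φ : Module.Dual ℂ (ℂ ⊗[ℚ] V)) (x : ℂ ⊗[ℚ] V),
        {g | φ (g.val x) - φ x = 0} := by
    ext g
    simp only [Subgroup.coe_bot, Set.mem_singleton_iff, Set.mem_iInter, Set.mem_ofPred_eq]
    constructor
    · rintro rfl φ x; exact sub_self _
    · intro h
      refine SpecialLinearGroup.ext _ _ fun x => ?_
      exact (Module.forall_dual_apply_eq_zero_iff ℂ (g.val x - x)).1
        (fun φ => by rw [map_sub]; exact h φ x) |> sub_eq_zero.1
  change IsClosed _
  rw [this]
  exact isClosed_iInter fun φ => isClosed_iInter fun x => isClosed_eq_zero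
    ((regularFunctions V).sub_mem (regular_dual_apply φ x)
      ((regularFunctions V).algebraMap_mem (φ x)))

/-! ### The Lie–Kolchin theorem -/

/-- A connected set which is covered by finitely many closed sets, pairwise disjoint on it, lies in
any of them which it meets. -/
theorem subset_of_finite_closed_cover {X ι : Type*} [TopologicalSpace X] {C : Set X}
    (hC : IsPreconnected C) {s : Set ι} (hs : s.Finite) {Z : ι → Set X}
    (hZ : ∀ i, IsClosed (Z i)) (hcov : ∀ x ∈ C, ∃ i ∈ s, x ∈ Z i)
    (hdisj : ∀ x ∈ C, ∀ i j, x ∈ Z i → x ∈ Z j → i = j) {i₀ : ι} {x₀ : X} (hx₀ : x₀ ∈ C)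
    (hi₀ : x₀ ∈ Z i₀) : C ⊆ Z i₀ := by
  intro x hx
  by_contra hxZ
  obtain ⟨i, hi, hxi⟩ := hcov x hx
  have hne : i ≠ i₀ := fun h => hxZ (h ▸ hxi)
  have hcl : IsClosed (⋃ i ∈ s \ {i₀}, Z i) := (hs.subset Set.sdiff_subset).isClosed_biUnion
    fun i _ => hZ i
  obtain ⟨y, hy, hy1, hy2⟩ := isPreconnected_closed_iff.1 hC _ _ (hZ i₀) hcl
    (fun y hy => by
      obtain ⟨j, hj, hyj⟩ := hcov y hy
      by_cases h : j = i₀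
      · exact Or.inl (h ▸ hyj)
      · exact Or.inr (Set.mem_biUnion (show j ∈ s \ {i₀} from ⟨hj, h⟩) hyj))
    ⟨x₀, hx₀, hi₀⟩ ⟨x, hx, Set.mem_biUnion (show i ∈ s \ {i₀} from ⟨hi, hne⟩) hxi⟩
  obtain ⟨j, hj, hyj⟩ := Set.mem_iUnion₂.1 hy2
  exact hj.2 (hdisj y hy _ _ hyj hy1)

theorem isClosed_setOf_eq
    {φ ψ : SpecialLinearGroup ℂ (ℂ ⊗[ℚ] V) → ℂ ⊗[ℚ] V}
    (hφ : ∀ l : Module.Dual ℂ (ℂ ⊗[ℚ] V), (fun g => l (φ g)) ∈ regularFunctions V)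
    (hψ : ∀ l : Module.Dual ℂ (ℂ ⊗[ℚ] V), (fun g => l (ψ g)) ∈ regularFunctions V) :
    IsClosed {g | φ g = ψ g} := by
  have : {g | φ g = ψ g} = ⋂ l : Module.Dual ℂ (ℂ ⊗[ℚ] V), {g | l (φ g) - l (ψ g) = 0} := by
    ext g
    simp only [Set.mem_iInter, Set.mem_ofPred_eq]
    refine ⟨fun h l => by rw [h, sub_self], fun h => ?_⟩
    exact sub_eq_zero.1 ((Module.forall_dual_apply_eq_zero_iff ℂ _).1
      fun l => by rw [map_sub]; exact h l)
  rw [this]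
  exact isClosed_iInter fun l => isClosed_eq_zero ((regularFunctions V).sub_mem (hφ l) (hψ l))

/-- The space of common eigenvectors of `N` with the eigenvalues `χ`. -/
def weightSpace (N : Subgroup (SpecialLinearGroup ℂ (ℂ ⊗[ℚ] V)))
    (χ : SpecialLinearGroup ℂ (ℂ ⊗[ℚ] V) → ℂ) : Submodule ℂ (ℂ ⊗[ℚ] V) where
  carrier := {x | ∀ n ∈ N, n.val x = χ n • x}
  zero_mem' := fun n _ => by simp
  add_mem' := fun {x y} hx hy n hn => by rw [map_add, hx n hn, hy n hn, smul_add]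
  smul_mem' := fun c x hx n hn => by rw [map_smul, hx n hn, smul_comm]

/-- A connected group which normalizes `N` preserves the weight spaces of `N`: for fixed `n`, the
eigenvalue of `g⁻¹ * n * g` is one of the finitely many eigenvalues of `n`, so that it does not
depend on `g`. -/
theorem weightSpace_stable {G N : Subgroup (SpecialLinearGroup ℂ (ℂ ⊗[ℚ] V))}
    (hG : IsZariskiConnected G) (hN : ∀ g ∈ G, ∀ n ∈ N, g⁻¹ * n * g ∈ N)
    {χ : SpecialLinearGroup ℂ (ℂ ⊗[ℚ] V) → ℂ} {x : ℂ ⊗[ℚ] V} (hx : x ∈ weightSpace N χ)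
    {g : SpecialLinearGroup ℂ (ℂ ⊗[ℚ] V)} (hg : g ∈ G) : g.val x ∈ weightSpace N χ := by
  intro n hn
  by_cases hx0 : x = 0
  · simp [hx0]
  let T : Module.End ℂ (ℂ ⊗[ℚ] V) := (n.val : (ℂ ⊗[ℚ] V) →ₗ[ℂ] (ℂ ⊗[ℚ] V))
  let Z : ℂ → Set (SpecialLinearGroup ℂ (ℂ ⊗[ℚ] V)) := fun c => {g | n.val (g.val x) = c • g.val x}
  have hgx (g : SpecialLinearGroup ℂ (ℂ ⊗[ℚ] V)) : g.val x ≠ 0 := by simpa using hx0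
  have hZ : ∀ c, IsClosed (Z c) := fun c => isClosed_setOf_eq
    (fun l => regular_dual_apply (l.comp T) x) (fun l => by
      simpa using regular_dual_apply (c • l) x)
  refine subset_of_finite_closed_cover hG.isPreconnected
    (Module.End.finite_hasEigenvalue T) hZ (fun g hg => ?_) (fun g _ i j hi hj => ?_)
    G.one_mem (i₀ := χ n) (hx n hn) hg
  · have h1 := hx _ (hN g hg n hn)
    have h2 : n.val (g.val x) = χ (g⁻¹ * n * g) • g.val x := by
      rw [← map_smul, ← h1]
      exact (g.val.apply_symm_apply _).symm
    exact ⟨_, Module.End.hasEigenvalue_of_hasEigenvector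
      ⟨Module.End.mem_eigenspace_iff.2 h2, hgx g⟩, h2⟩
  · exact smul_left_injective ℂ (hgx g) ((hi : _ = _).symm.trans hj)

/-- If the eigenvalues of a connected group on a line lie in a finite set, the group acts trivially
on the line. -/
theorem apply_eq_self_of_finite {N : Subgroup (SpecialLinearGroup ℂ (ℂ ⊗[ℚ] V))}
    (hN : IsZariskiConnected N) {x : ℂ ⊗[ℚ] V} (hx0 : x ≠ 0) {s : Set ℂ} (hs : s.Finite)
    (hx : ∀ n ∈ N, ∃ c ∈ s, n.val x = c • x) {n : SpecialLinearGroup ℂ (ℂ ⊗[ℚ] V)} (hn : n ∈ N) :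
    n.val x = x := by
  let Z : ℂ → Set (SpecialLinearGroup ℂ (ℂ ⊗[ℚ] V)) := fun c => {n | n.val x = c • x}
  have hZ : ∀ c, IsClosed (Z c) := fun c => isClosed_setOf_eq
    (fun l => regular_dual_apply l x) (fun l => (regularFunctions V).algebraMap_mem (l (c • x)))
  have := subset_of_finite_closed_cover hN.isPreconnected hs hZ hx
    (fun g _ i j hi hj => smul_left_injective ℂ hx0 ((hi : _ = _).symm.trans hj))
    N.one_mem (i₀ := 1) (one_smul ℂ x).symm hn
  exact this.trans (one_smul ℂ x)

/-- Commuting endomorphisms have a common eigenvector in every nonzero stable subspace. -/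
theorem exists_common_eigenvector_of_commute {M : Type*} [AddCommGroup M] [Module ℂ M]
    [FiniteDimensional ℂ M] (S : Set (Module.End ℂ M)) (W : Submodule ℂ M) (hW : W ≠ ⊥)
    (hS : ∀ f ∈ S, ∀ x ∈ W, f x ∈ W) (hc : ∀ f ∈ S, ∀ g ∈ S, ∀ x ∈ W, f (g x) = g (f x)) :
    ∃ x ∈ W, x ≠ 0 ∧ ∀ f ∈ S, ∃ c : ℂ, f x = c • x := by
  induction hn : finrank ℂ W using Nat.strong_induction_on generalizing W with
  | _ n ih =>
  subst hn
  by_cases hscal : ∀ f ∈ S, ∃ c : ℂ, ∀ x ∈ W, f x = c • x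
  · obtain ⟨x, hx, hx0⟩ := W.exists_mem_ne_zero_of_ne_bot hW
    exact ⟨x, hx, hx0, fun f hf => (hscal f hf).imp fun c h => h x hx⟩
  push Not at hscal
  obtain ⟨f, hf, hfc⟩ := hscal
  have : Nontrivial W := Submodule.nontrivial_iff_ne_bot.2 hW
  obtain ⟨c, hev⟩ := Module.End.exists_eigenvalue (f.restrict (hS f hf))
  obtain ⟨⟨v, hv⟩, hve⟩ := hev.exists_hasEigenvector
  have hfv : f v = c • v := congrArg Subtype.val hve.apply_eq_smul
  let U : Submodule ℂ M := W ⊓ Module.End.eigenspace f c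
  have hU {x : M} : x ∈ U ↔ x ∈ W ∧ f x = c • x := by
    rw [Submodule.mem_inf, Module.End.mem_eigenspace_iff]
  have hlt : finrank ℂ U < finrank ℂ W := by
    refine Submodule.finrank_lt_finrank_of_lt (lt_of_le_of_ne inf_le_left fun h => ?_)
    obtain ⟨x, hx, hxc⟩ := hfc c
    rw [← h] at hx
    exact hxc (hU.1 hx).2
  obtain ⟨x, hx, hx0, h⟩ := ih _ hlt U
    ((Submodule.ne_bot_iff _).2 ⟨v, hU.2 ⟨hv, hfv⟩, fun h => hve.2 (Subtype.ext h)⟩)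
    (fun g hg x hx => hU.2 ⟨hS g hg x (hU.1 hx).1, by
      rw [hc f hf g hg x (hU.1 hx).1, (hU.1 hx).2, map_smul]⟩)
    (fun g hg g' hg' x hx => hc g hg g' hg' x (hU.1 hx).1) rfl
  exact ⟨x, (hU.1 hx).1, hx0, h⟩

open scoped commutatorElement in
/-- The inductive step of the Lie–Kolchin theorem. On a weight space of `⁅G, G⁆` the determinant of
a commutator is one, so that the weight consists of roots of unity of bounded order and is trivial.
Hence `G` acts on the weight space through commuting endomorphisms. -/
theorem exists_eigenvector_of_commutator {G : Subgroup (SpecialLinearGroup ℂ (ℂ ⊗[ℚ] V))}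
    (hG : IsZariskiConnected G) {W : Submodule ℂ (ℂ ⊗[ℚ] V)}
    (hWG : ∀ g ∈ G, ∀ x ∈ W, g.val x ∈ W)
    (h : ∃ x ∈ W, x ≠ 0 ∧ ∀ g ∈ ⁅G, G⁆, ∃ c : ℂ, g.val x = c • x) :
    ∃ x ∈ W, x ≠ 0 ∧ ∀ g ∈ G, ∃ c : ℂ, g.val x = c • x := by
  obtain ⟨w, hw, hw0, hwN⟩ := h
  choose! χ hχ using hwN
  have hnorm : ∀ g ∈ G, ∀ n ∈ ⁅G, G⁆, g⁻¹ * n * g ∈ ⁅G, G⁆ := fun g hg n hn => by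
    have h1 : ⁅g⁻¹, n⁆ ∈ ⁅G, G⁆ := Subgroup.commutator_mem_commutator (G.inv_mem hg)
      (Subgroup.commutator_le_self G hn)
    have h2 := (⁅G, G⁆).mul_mem h1 hn
    rwa [commutatorElement_def, inv_inv, inv_mul_cancel_right] at h2
  let U := W ⊓ weightSpace ⁅G, G⁆ χ
  have hwU : w ∈ U := ⟨hw, hχ⟩
  have hUG : ∀ g ∈ G, ∀ x ∈ U, g.val x ∈ U := fun g hg x hx =>
    ⟨hWG g hg x hx.1, weightSpace_stable hG hnorm hx.2 hg⟩
  let ρ : G →* Module.End ℂ U :=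
    { toFun := fun g => (g.val.val : (ℂ ⊗[ℚ] V) →ₗ[ℂ] (ℂ ⊗[ℚ] V)).restrict (hUG g.val g.2)
      map_one' := by ext x; rfl
      map_mul' := fun g h => by ext x; rfl }
  have hdet : ∀ n ∈ ⁅G, G⁆, χ n ^ finrank ℂ U = 1 := fun n hn => by
    have hn' : n ∈ G := Subgroup.commutator_le_self G hn
    have hmem : (⟨n, hn'⟩ : G) ∈ commutator G := by
      rw [show ⁅G, G⁆ = (derivedSeries G 1).map G.subtype from (map_derivedSeries G 1).symm] at hn
      obtain ⟨m, hm, rfl⟩ := hn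
      rwa [derivedSeries_one] at hm
    have h1 : (LinearMap.det.comp ρ).toHomUnits ⟨n, hn'⟩ = 1 :=
      Abelianization.commutator_subset_ker _ hmem
    have h2 : LinearMap.det (ρ ⟨n, hn'⟩) = 1 := congrArg Units.val h1
    have h3 : ρ ⟨n, hn'⟩ = χ n • LinearMap.id := by
      ext x
      exact x.2.2 n hn
    rw [h3, LinearMap.det_smul, LinearMap.det_id, mul_one] at h2
    exact h2
  have : Nontrivial U := ⟨⟨⟨w, hwU⟩, 0, fun h => hw0 (congrArg Subtype.val h)⟩⟩
  have hpos : 0 < finrank ℂ U := finrank_pos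
  have htriv : ∀ n ∈ ⁅G, G⁆, ∀ x ∈ U, n.val x = x := fun n hn x hx => by
    by_cases hx0 : x = 0
    · rw [hx0, map_zero]
    refine apply_eq_self_of_finite hG.commutator hx0 (s := {c | c ^ finrank ℂ U = 1}) ?_
      (fun n hn => ⟨χ n, hdet n hn, hx.2 n hn⟩) hn
    have := (Polynomial.nthRoots (finrank ℂ U) (1 : ℂ)).toFinset.finite_toSet
    refine this.subset fun c hc => ?_
    simpa [Polynomial.mem_nthRoots hpos] using hc
  obtain ⟨x, hx, hx0, hxe⟩ := exists_common_eigenvector_of_commute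
    ((fun g : SpecialLinearGroup ℂ (ℂ ⊗[ℚ] V) => (g.val : (ℂ ⊗[ℚ] V) →ₗ[ℂ] (ℂ ⊗[ℚ] V))) '' G) U
    ((Submodule.ne_bot_iff _).2 ⟨w, hwU, hw0⟩)
    (by rintro _ ⟨g, hg, rfl⟩ x hx; exact hUG g hg x hx)
    (by
      rintro _ ⟨g, hg, rfl⟩ _ ⟨g', hg', rfl⟩ x hx
      have h1 := htriv ⁅g, g'⁆ (Subgroup.commutator_mem_commutator hg hg') (g'.val (g.val x))
        (hUG _ hg' _ (hUG _ hg _ hx))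
      have h2 : ⁅g, g'⁆ * (g' * g) = g * g' := by rw [commutatorElement_def]; group
      have h3 : (⁅g, g'⁆ * (g' * g)).val x = g'.val (g.val x) := h1
      rw [h2] at h3
      exact h3)
  exact ⟨x, hx.1, hx0, fun g hg => hxe _ ⟨g, hg, rfl⟩⟩

/-- **Lie–Kolchin**: a connected solvable group has a common eigenvector in every nonzero stable
subspace. -/
theorem exists_eigenvector_of_isSolvable {G : Subgroup (SpecialLinearGroup ℂ (ℂ ⊗[ℚ] V))}
    (hG : IsZariskiConnected G) (hsol : Group.IsSolvable G) {W : Submodule ℂ (ℂ ⊗[ℚ] V)}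
    (hW : W ≠ ⊥) (hWG : ∀ g ∈ G, ∀ x ∈ W, g.val x ∈ W) :
    ∃ x ∈ W, x ≠ 0 ∧ ∀ g ∈ G, ∃ c : ℂ, g.val x = c • x := by
  obtain ⟨n, hn⟩ := (isSolvable_iff_derivedSubgroup G).1 hsol
  induction n generalizing G with
  | zero =>
    obtain ⟨x, hx, hx0⟩ := W.exists_mem_ne_zero_of_ne_bot hW
    refine ⟨x, hx, hx0, fun g hg => ⟨1, ?_⟩⟩
    have hg1 : g = 1 := Subgroup.mem_bot.1 (hn ▸ hg)
    rw [hg1, one_smul]; rfl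
  | succ n ih =>
    have hshift (n : ℕ) : derivedSubgroup ⁅G, G⁆ n = derivedSubgroup G (n + 1) := by
      induction n with
      | zero => rfl
      | succ n ih => rw [derivedSubgroup, ih]; rfl
    rw [← hshift] at hn
    exact exists_eigenvector_of_commutator hG hWG (ih hG.commutator
      ((isSolvable_iff_derivedSubgroup _).2 ⟨n, hn⟩)
      (fun g hg => hWG g (Subgroup.commutator_le_self G hg)) hn)

end LieKolchin

section Rational

variable {V : Type*} [AddCommGroup V] [Module ℚ V] {q : QuadraticForm ℚ V}

/-! ### Complexification and complex conjugation -/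

theorem polar_baseChange_tmul (q : QuadraticForm ℚ V) (a b : ℂ) (v w : V) :
    polar (q.baseChange ℂ) (a ⊗ₜ[ℚ] v) (b ⊗ₜ[ℚ] w) = a * b * (polar q v w : ℚ) := by
  have : Invertible (2 : ℂ) := invertibleOfNonzero two_ne_zero
  rw [← polarBilin_apply_apply, QuadraticForm.polarBilin_baseChange,
    LinearMap.BilinForm.baseChange_tmul, polarBilin_apply_apply, Algebra.smul_def]
  rw [mul_comm]; rfl

theorem exists_sum_of_mem_baseChange {W : Submodule ℚ V} {ι : Type*} [Fintype ι]
    (b : Basis ι ℚ W) {x : ℂ ⊗[ℚ] V} (hx : x ∈ W.baseChange ℂ) :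
    ∃ c : ι → ℂ, x = ∑ i, c i ⊗ₜ[ℚ] (b i : V) := by
  rw [Submodule.baseChange_eq_span] at hx
  induction hx using Submodule.span_induction with
  | mem x hx =>
    obtain ⟨w, hw, rfl⟩ := hx
    refine ⟨fun i => (b.repr ⟨w, hw⟩ i : ℚ), ?_⟩
    have h1 : w = ∑ i, b.repr ⟨w, hw⟩ i • (b i : V) := by
      have := congrArg W.subtype (b.sum_repr ⟨w, hw⟩)
      rw [map_sum] at this
      exact this.symm
    conv_lhs => rw [h1]
    rw [TensorProduct.mk_apply, TensorProduct.tmul_sum]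
    refine Finset.sum_congr rfl fun i _ => ?_
    rw [← TensorProduct.smul_tmul, Algebra.smul_def, mul_one]; rfl
  | zero => exact ⟨0, by simp⟩
  | add x y _ _ hx hy =>
    obtain ⟨c, rfl⟩ := hx
    obtain ⟨d, rfl⟩ := hy
    exact ⟨c + d, by simp [TensorProduct.add_tmul, Finset.sum_add_distrib]⟩
  | smul a x _ hx =>
    obtain ⟨c, rfl⟩ := hx
    exact ⟨fun i => a * c i, by simp [Finset.smul_sum, TensorProduct.smul_tmul']⟩

theorem polar_sum_orthogonal {W : Submodule ℚ V} {ι : Type*} [Fintype ι] {b : Basis ι ℚ W}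
    (hb : ∀ i j, i ≠ j → polar q (b i : V) (b j) = 0) (c : ι → ℂ) (a : ℂ) (j : ι) :
    polar (q.baseChange ℂ) (a ⊗ₜ[ℚ] (b j : V)) (∑ i, c i ⊗ₜ[ℚ] (b i : V)) =
      a * c j * (2 * q (b j) : ℚ) := by
  rw [← polarBilin_apply_apply, map_sum, Finset.sum_eq_single j]
  · rw [polarBilin_apply_apply, polar_baseChange_tmul, polar_self]; simp
  · intro i _ hij
    rw [polarBilin_apply_apply, polar_baseChange_tmul, hb j i hij.symm]; simp
  · simp

theorem polar_baseChange_eq_zero {W U : Submodule ℚ V} (h : ∀ w ∈ W, ∀ u ∈ U, polar q w u = 0)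
    {x y : ℂ ⊗[ℚ] V} (hx : x ∈ W.baseChange ℂ) (hy : y ∈ U.baseChange ℂ) :
    polar (q.baseChange ℂ) x y = 0 := by
  rw [Submodule.baseChange_eq_span] at hx hy
  induction hx using Submodule.span_induction with
  | zero => simp
  | add x x' _ _ hx hx' => rw [polar_add_left, hx, hx', add_zero]
  | smul a x _ hx => rw [polar_smul_left, hx, smul_zero]
  | mem x hx =>
    obtain ⟨w, hw, rfl⟩ := hx
    induction hy using Submodule.span_induction with
    | zero => simp
    | add x x' _ _ hx hx' => rw [polar_add_right, hx, hx', add_zero]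
    | smul a x _ hx => rw [polar_smul_right, hx, smul_zero]
    | mem y hy =>
      obtain ⟨u, hu, rfl⟩ := hy
      rw [TensorProduct.mk_apply, TensorProduct.mk_apply, polar_baseChange_tmul, h w hw u hu]
      simp

variable (V) in
/-- Complex conjugation on the first factor of `ℂ ⊗ V`. -/
def conjTensor : ℂ ⊗[ℚ] V →ₗ[ℚ] ℂ ⊗[ℚ] V :=
  LinearMap.rTensor V (Complex.conjAe.toLinearMap.restrictScalars ℚ)

theorem conjTensor_tmul (c : ℂ) (v : V) : conjTensor V (c ⊗ₜ[ℚ] v) = (starRingEnd ℂ c) ⊗ₜ[ℚ] v := by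
  simp [conjTensor]

theorem conjTensor_smul (c : ℂ) (x : ℂ ⊗[ℚ] V) :
    conjTensor V (c • x) = starRingEnd ℂ c • conjTensor V x := by
  induction x with
  | zero => simp
  | add x y hx hy => rw [smul_add, map_add, hx, hy, map_add, smul_add]
  | tmul a v => simp [TensorProduct.smul_tmul', conjTensor_tmul]

theorem conjTensor_conjTensor (x : ℂ ⊗[ℚ] V) : conjTensor V (conjTensor V x) = x := by
  induction x with
  | zero => simp
  | add x y hx hy => rw [map_add, map_add, hx, hy]
  | tmul a v => simp [conjTensor_tmul]

theorem polar_conjTensor (q : QuadraticForm ℚ V) (x y : ℂ ⊗[ℚ] V) :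
    polar (q.baseChange ℂ) (conjTensor V x) (conjTensor V y) =
      starRingEnd ℂ (polar (q.baseChange ℂ) x y) := by
  induction x with
  | zero => simp
  | add x x' hx hx' => rw [map_add, polar_add_left, hx, hx', polar_add_left, map_add]
  | tmul a v =>
    induction y with
    | zero => simp
    | add x x' hx hx' => rw [map_add, polar_add_right, hx, hx', polar_add_right, map_add]
    | tmul b w => simp [conjTensor_tmul, polar_baseChange_tmul]

theorem map_conjTensor (q : QuadraticForm ℚ V) (x : ℂ ⊗[ℚ] V) :
    q.baseChange ℂ (conjTensor V x) = starRingEnd ℂ (q.baseChange ℂ x) := by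
  have h := polar_conjTensor q x x
  rw [polar_self, polar_self, nsmul_eq_mul, nsmul_eq_mul, map_mul] at h
  rw [map_natCast] at h
  exact mul_left_cancel₀ (by norm_num) h

theorem eichlerMap_conjTensor (q : QuadraticForm ℚ V) (e v x : ℂ ⊗[ℚ] V) :
    eichlerMap (q.baseChange ℂ) (conjTensor V e) (conjTensor V v) (conjTensor V x) =
      conjTensor V (eichlerMap (q.baseChange ℂ) e v x) := by
  simp only [eichlerMap, polar_conjTensor, map_conjTensor, map_add, map_sub, conjTensor_smul,
    map_mul]

theorem dual_baseChange_conjTensor (φ : Module.Dual ℚ V) (x : ℂ ⊗[ℚ] V) :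
    Module.Dual.baseChange ℂ φ (conjTensor V x) = starRingEnd ℂ (Module.Dual.baseChange ℂ φ x) := by
  induction x with
  | zero => simp
  | add x y hx hy => simp only [map_add, hx, hy]
  | tmul a v => simp [conjTensor_tmul, Algebra.smul_def]

/-! ### Signatures and orthogonal complements -/

variable [FiniteDimensional ℚ V]

theorem HasSignature.nondegenerateOn_top {a b : ℕ} (h : HasSignature q a b) :
    NondegenerateOn q ⊤ := fun x _ hx => by
  have h1 := QuadraticForm.sigPos_add_sigNeg_add_radical (Q := q)
  rw [h.1, h.2.1, h.2.2] at h1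
  have h2 : q.radical = ⊥ := Submodule.finrank_eq_zero.1 (by omega)
  have h3 : x ∈ q.radical := by
    refine ⟨?_, LinearMap.ext fun y => ?_⟩
    · have := hx x trivial
      rw [polar_self] at this
      simpa using this
    · rw [polarBilin_apply_apply, polar_comm]; exact hx y trivial
  rwa [h2, Submodule.mem_bot] at h3

theorem HasSignature.nondegenerateOn {V' : Submodule ℚ V} {a b : ℕ}
    (h : HasSignature (q.restrict V') a b) : NondegenerateOn q V' := fun x hx hxy =>
  congrArg Subtype.val (h.nondegenerateOn_top ⟨x, hx⟩ trivial fun y _ => hxy y.1 y.2)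

/-- If a nondegenerate subspace `V'` of `V` has the same number of negative squares as `V`, then the
orthogonal complement of `V'` is positive definite. -/
theorem HasSignature.pos_of_orthogonal {V' : Submodule ℚ V} {n r m : ℕ} (hq : HasSignature q n m)
    (h : HasSignature (q.restrict V') r m) {v : V} (hv : v ∈ perp q V') (hv0 : v ≠ 0) :
    0 < q v := by
  have hV' := h.nondegenerateOn
  -- negative vectors orthogonal to `V'` would enlarge a maximal negative definite subspace of `V'`
  have hnonneg : ∀ w ∈ perp q V', 0 ≤ q w := by
    intro w hw
    by_contra! hneg
    obtain ⟨N, hN, hNd⟩ := exists_finrank_eq_sigNeg_and_negDef (q.restrict V')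
    rw [h.2.1] at hN
    let N' : Submodule ℚ V := N.map V'.subtype
    have hN'r : finrank ℚ N' = m := by
      rw [← hN]; exact (Submodule.equivMapOfInjective _ V'.subtype_injective N).finrank_eq.symm
    have hN'd : ∀ x ∈ N', x ≠ 0 → q x < 0 := by
      rintro _ ⟨x, hx, rfl⟩ hx0
      have := hNd ⟨x, hx⟩ (fun h0 => hx0 (by
        have := congrArg Subtype.val h0
        simpa using this))
      simpa using this
    have hN'V : N' ≤ V' := Submodule.map_subtype_le V' N
    have hwN : w ∉ N' := fun hwN => by
      have : polar q w w = 0 := hw w (hN'V hwN)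
      rw [polar_self, nsmul_eq_mul] at this
      have : q w = 0 := by simpa using this
      exact hneg.ne this
    have hle := le_sigNeg_of_negDef (Q := q) (V := N' ⊔ Submodule.span ℚ {w}) (by
      rintro ⟨x, hx⟩ hx0
      obtain ⟨y, hy, z, hz, rfl⟩ := Submodule.mem_sup.1 hx
      obtain ⟨c, rfl⟩ := Submodule.mem_span_singleton.1 hz
      change 0 < -q (y + c • w)
      have hyw : polar q y w = 0 := hw y (hN'V hy)
      rw [QuadraticMap.map_add q, polar_smul_right, hyw, QuadraticMap.map_smul]
      by_cases hy0 : y = 0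
      · have hc : c ≠ 0 := by
          rintro rfl; exact hx0 (by simp [hy0])
        have := mul_pos (mul_self_pos.2 hc) (neg_pos.2 hneg)
        simp only [hy0, QuadraticMap.map_zero, smul_eq_mul]
        linarith
      · have := hN'd y hy hy0
        have := mul_nonneg (mul_self_nonneg c) (neg_pos.2 hneg).le
        simp only [smul_eq_mul]
        linarith)
    have hlt : finrank ℚ N' < finrank ℚ (N' ⊔ Submodule.span ℚ {w} : Submodule ℚ V) :=
      Submodule.finrank_lt_finrank_of_lt (lt_of_le_of_ne le_sup_left fun he => hwN
        (he ▸ (le_sup_right : _ ≤ N' ⊔ Submodule.span ℚ {w}) (Submodule.mem_span_singleton_self w)))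
    rw [hq.2.1] at hle
    omega
  refine lt_of_le_of_ne (hnonneg v hv) fun hQv => ?_
  -- an isotropic vector of the complement is orthogonal to everything
  refine hv0 (hq.nondegenerateOn_top v trivial fun y _ => ?_)
  obtain ⟨w, hw, hyw⟩ := hV'.exists_sub_orthogonal y
  have hz : y - w ∈ perp q V' := hyw
  have e1 : polar q y v = polar q (y - w) v := by
    rw [polar_sub_left, hv w hw, sub_zero]
  rw [e1]
  set z := y - w
  by_contra hne
  have hlin (t : ℚ) : 0 ≤ q z + t * polar q z v := by
    have hm : z + t • v ∈ perp q V' := fun x hx => by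
      rw [polar_add_right, polar_smul_right, hz x hx, hv x hx]; simp
    have := hnonneg _ hm
    rw [QuadraticMap.map_add q, QuadraticMap.map_smul, ← hQv, polar_smul_right] at this
    simpa using this
  have := hlin (-(q z + 1) / polar q z v)
  rw [div_mul_cancel₀ _ hne] at this
  linarith

/-- A nondegenerate subspace has an orthogonal basis of anisotropic vectors. -/
theorem NondegenerateOn.exists_orthogonal_family {W : Submodule ℚ V} (hW : NondegenerateOn q W) :
    ∃ b : Basis (Fin (finrank ℚ W)) ℚ W, (∀ i j, i ≠ j → polar q (b i : V) (b j) = 0) ∧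
      ∀ i, q (b i) ≠ 0 := by
  have : Invertible (2 : ℚ) := invertibleOfNonzero two_ne_zero
  obtain ⟨b, hb⟩ := LinearMap.BilinForm.exists_orthogonal_basis
    (QuadraticForm.associated_isSymm ℚ (q.restrict W))
  have horth : ∀ i j, i ≠ j → polar q (b i : V) (b j) = 0 := fun i j hij => by
    have h1 := LinearMap.BilinForm.iIsOrtho_def.1 hb i j hij
    have h2 := LinearMap.congr_fun₂ (two_nsmul_associated ℚ (q.restrict W)) (b i) (b j)
    change 2 • associated (R := ℚ) (q.restrict W) (b i) (b j) = polar q (b i : V) (b j) at h2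
    rw [← h2, h1, smul_zero]
  refine ⟨b, horth, fun i hi => b.ne_zero i (Subtype.ext (hW _ (b i).2 fun y hy => ?_))⟩
  have h5 : polar q (b i : V) y = 0 := by
    have h6 : (q.restrict W).polarBilin (b i) = 0 := b.ext fun j => by
      change polar q (b i : V) (b j) = 0
      by_cases hij : i = j
      · rw [← hij, polar_self, hi, smul_zero]
      · exact horth i j hij
    exact congrFun (congrArg DFunLike.coe h6) ⟨y, hy⟩
  rw [polar_comm, h5]

theorem NondegenerateOn.baseChange {W : Submodule ℚ V} (hW : NondegenerateOn q W) :
    NondegenerateOn (q.baseChange ℂ) (W.baseChange ℂ) := fun x hx hxy => by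
  obtain ⟨b, hb, hbq⟩ := hW.exists_orthogonal_family
  obtain ⟨c, rfl⟩ := exists_sum_of_mem_baseChange b hx
  refine Finset.sum_eq_zero fun j _ => ?_
  have h1 := hxy _ (Submodule.tmul_mem_baseChange_of_mem 1 (b j).2)
  rw [polar_sum_orthogonal hb, one_mul] at h1
  have h2 : ((2 * q (b j) : ℚ) : ℂ) ≠ 0 := by exact_mod_cast mul_ne_zero two_ne_zero (hbq j)
  rw [(mul_eq_zero.1 h1).resolve_right h2, TensorProduct.zero_tmul]

theorem finrank_baseChange_submodule (W : Submodule ℚ V) :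
    finrank ℂ (W.baseChange ℂ) = finrank ℚ W := by
  rw [Submodule.baseChange, LinearMap.finrank_range_of_inj, finrank_baseChange]
  exact Module.Flat.lTensor_preserves_injective_linearMap _ W.subtype_injective

variable (q) in
/-- The orthogonal complement of a subspace, as a subspace. -/
def perpSubmodule (W : Submodule ℚ V) : Submodule ℚ V where
  carrier := perp q W
  zero_mem' := fun v _ => by simp
  add_mem' := fun {x y} hx hy v hv => by rw [polar_add_right, hx v hv, hy v hv, add_zero]
  smul_mem' := fun c x hx v hv => by rw [polar_smul_right, hx v hv, smul_zero]

/-- The complexified orthogonal complement is the orthogonal complement of the complexification. -/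
theorem mem_baseChange_perp_iff {W : Submodule ℚ V} (hW : NondegenerateOn q W) {x : ℂ ⊗[ℚ] V} :
    x ∈ (perpSubmodule q W).baseChange ℂ ↔
      ∀ y ∈ W.baseChange ℂ, polar (q.baseChange ℂ) y x = 0 := by
  have horth : ∀ w ∈ W, ∀ u ∈ perpSubmodule q W, polar q w u = 0 := fun w hw u hu => hu w hw
  refine ⟨fun hx y hy => polar_baseChange_eq_zero horth hy hx, fun hx => ?_⟩
  have hdec (x : ℂ ⊗[ℚ] V) : ∃ w ∈ W.baseChange ℂ, ∃ z ∈ (perpSubmodule q W).baseChange ℂ,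
      x = w + z := by
    induction x with
    | zero => exact ⟨0, zero_mem _, 0, zero_mem _, by simp⟩
    | add x y hx hy =>
      obtain ⟨w, hw, z, hz, rfl⟩ := hx
      obtain ⟨w', hw', z', hz', rfl⟩ := hy
      exact ⟨_, add_mem hw hw', _, add_mem hz hz', by abel⟩
    | tmul c v =>
      obtain ⟨w, hw, hvw⟩ := hW.exists_sub_orthogonal v
      exact ⟨_, Submodule.tmul_mem_baseChange_of_mem c hw, _,
        Submodule.tmul_mem_baseChange_of_mem (p := perpSubmodule q W) c (m := v - w) hvw,
        by rw [← TensorProduct.tmul_add, add_sub_cancel]⟩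
  obtain ⟨w, hw, z, hz, rfl⟩ := hdec x
  have hw0 : w = 0 := hW.baseChange w hw fun y hy => by
    have := hx y hy
    rwa [polar_add_right, polar_baseChange_eq_zero horth hy hz, add_zero] at this
  rwa [hw0, zero_add]

/-- A hermitian form attached to a positive definite rational form is positive definite. -/
theorem polar_conjTensor_ne_zero {U : Submodule ℚ V} (hU : ∀ u ∈ U, u ≠ 0 → 0 < q u)
    {x : ℂ ⊗[ℚ] V} (hx : x ∈ U.baseChange ℂ) (hx0 : x ≠ 0) :
    polar (q.baseChange ℂ) (conjTensor V x) x ≠ 0 := by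
  have hUn : NondegenerateOn q U := fun u hu h => by
    by_contra hu0
    have := h u hu
    rw [polar_self, nsmul_eq_mul] at this
    exact (hU u hu hu0).ne' (by simpa using this)
  obtain ⟨b, hb, -⟩ := hUn.exists_orthogonal_family
  obtain ⟨c, rfl⟩ := exists_sum_of_mem_baseChange b hx
  have hpos (i) : 0 < q (b i) := hU _ (b i).2 fun h => b.ne_zero i (Subtype.ext h)
  have hcalc : polar (q.baseChange ℂ) (conjTensor V (∑ i, c i ⊗ₜ[ℚ] (b i : V)))
      (∑ i, c i ⊗ₜ[ℚ] (b i : V)) = ((∑ i, Complex.normSq (c i) * (2 * q (b i) : ℚ) : ℝ) : ℂ) := by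
    rw [map_sum, ← polarBilin_apply_apply, LinearMap.map_sum₂]
    push_cast
    refine Finset.sum_congr rfl fun i _ => ?_
    rw [polarBilin_apply_apply, conjTensor_tmul, polar_sum_orthogonal hb, mul_comm _ (c i),
      Complex.mul_conj]
    push_cast; rfl
  rw [hcalc]
  intro h0
  have h0' : ∑ i, Complex.normSq (c i) * ((2 * q (b i) : ℚ) : ℝ) = 0 := by exact_mod_cast h0
  have hnn : ∀ i, 0 < ((2 * q (b i) : ℚ) : ℝ) := fun i => by
    have := hpos i
    exact_mod_cast (by positivity : (0 : ℚ) < 2 * q (b i))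
  rw [Finset.sum_eq_zero_iff_of_nonneg fun i _ => mul_nonneg (Complex.normSq_nonneg _) (hnn i).le]
    at h0'
  refine hx0 (Finset.sum_eq_zero fun i hi => ?_)
  have := (mul_eq_zero.1 (h0' i hi)).resolve_right (hnn i).ne'
  rw [Complex.normSq_eq_zero.1 this, TensorProduct.zero_tmul]

end Rational

section Groups

variable {V : Type*} [AddCommGroup V] [Module ℚ V] {q : QuadraticForm ℚ V}

attribute [local instance] zariskiTopology

/-! ### Rationality of orthogonal groups -/

theorem IsQGroup.isAlgebraic {H : Subgroup (SpecialLinearGroup ℂ (ℂ ⊗[ℚ] V))} (hH : IsQGroup H) :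
    IsAlgebraic H := by
  obtain ⟨I, hI⟩ := (isClosed_iff_zeroLocus ℚ).1 hH
  refine (isClosed_iff_zeroLocus ℂ).2 ⟨MvPolynomial.map (algebraMap ℚ ℂ) '' I, ?_⟩
  rw [hI]
  ext g
  simp [zeroLocus, MvPolynomial.aeval_def]

theorem mem_specialOrthogonal_iff_polar {g : SpecialLinearGroup ℂ (ℂ ⊗[ℚ] V)} :
    g ∈ SO q ↔ ∀ v w : V, polar (q.baseChange ℂ) (g.val ((1 : ℂ) ⊗ₜ[ℚ] v))
      (g.val ((1 : ℂ) ⊗ₜ[ℚ] w)) = (polar q v w : ℚ) := by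
  constructor
  · intro hg v w
    rw [polar_map_eq hg, polar_baseChange_tmul, one_mul, one_mul]
  · intro h
    have key (x y : ℂ ⊗[ℚ] V) :
        polar (q.baseChange ℂ) (g.val x) (g.val y) = polar (q.baseChange ℂ) x y := by
      induction x with
      | zero => simp
      | add x x' hx hx' => rw [map_add, polar_add_left, hx, hx', polar_add_left]
      | tmul a v =>
        induction y with
        | zero => simp
        | add x x' hx hx' => rw [map_add, polar_add_right, hx, hx', polar_add_right]
        | tmul b w =>
          have ha : a ⊗ₜ[ℚ] v = a • ((1 : ℂ) ⊗ₜ[ℚ] v) := by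
            rw [TensorProduct.smul_tmul', smul_eq_mul, mul_one]
          have hb : b ⊗ₜ[ℚ] w = b • ((1 : ℂ) ⊗ₜ[ℚ] w) := by
            rw [TensorProduct.smul_tmul', smul_eq_mul, mul_one]
          rw [polar_baseChange_tmul, ha, hb, map_smul, map_smul, polar_smul_left, polar_smul_right,
            h, smul_eq_mul, smul_eq_mul, mul_assoc]
    intro x
    have := key x x
    rw [polar_self, polar_self, nsmul_eq_mul, nsmul_eq_mul] at this
    exact mul_left_cancel₀ (by norm_num) this

/-- The Eichler transformations attached to the multiples of a vector form a connected set. -/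
theorem isPreconnected_range_eichler {e v : ℂ ⊗[ℚ] V} (he : q.baseChange ℂ e = 0)
    (hev : ∀ t : ℂ, polar (q.baseChange ℂ) e (t • v) = 0) :
    IsPreconnected (Set.range fun t => eichler (q.baseChange ℂ) he (hev t)) := by
  refine isPreconnected_range_of_polynomial fun i => ?_
  set φ := Module.Dual.baseChange ℂ i.2
  set x := (1 : ℂ) ⊗ₜ[ℚ] i.1
  set Q := q.baseChange ℂ
  refine ⟨Polynomial.C (φ x) + Polynomial.C (polar Q e x * φ v - polar Q v x * φ e) * Polynomial.X -
    Polynomial.C (Q v * polar Q e x * φ e) * Polynomial.X ^ 2, fun t => ?_⟩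
  change φ ((eichler Q he (hev t)).val x) = _
  rw [eichler_apply, eichlerMap]
  simp only [map_add, map_sub, map_smul, polar_smul_left, QuadraticMap.map_smul, smul_eq_mul,
    Polynomial.eval_add, Polynomial.eval_sub, Polynomial.eval_mul, Polynomial.eval_C,
    Polynomial.eval_X, Polynomial.eval_pow]
  ring

/-- An Eichler transformation can be joined to `1` by Eichler transformations. -/
theorem exists_isPreconnected_eichler {G : Subgroup (SpecialLinearGroup ℂ (ℂ ⊗[ℚ] V))}
    {e v : ℂ ⊗[ℚ] V} (he : q.baseChange ℂ e = 0) (hev : polar (q.baseChange ℂ) e v = 0)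
    (hG : ∀ t : ℂ, ∀ h : polar (q.baseChange ℂ) e (t • v) = 0,
      eichler (q.baseChange ℂ) he h ∈ G) :
    ∃ C ⊆ (G : Set (SpecialLinearGroup ℂ (ℂ ⊗[ℚ] V))), IsPreconnected C ∧
      1 ∈ C ∧ eichler (q.baseChange ℂ) he hev ∈ C := by
  have h (t : ℂ) : polar (q.baseChange ℂ) e (t • v) = 0 := by
    rw [polar_smul_right, hev, smul_zero]
  refine ⟨_, ?_, isPreconnected_range_eichler he h, ⟨0, ?_⟩, ⟨1, ?_⟩⟩
  · rintro _ ⟨t, rfl⟩; exact hG t _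
  · refine SpecialLinearGroup.ext _ _ fun x => (eichler_apply _ _ _).trans ?_
    simp only [eichlerMap, zero_smul, smul_zero, add_zero, polar_zero_left, QuadraticMap.map_zero,
      zero_mul, sub_zero]
    rfl
  · simp only [one_smul]

variable [FiniteDimensional ℚ V]

theorem isQGroup_subSO (q : QuadraticForm ℚ V) (V' : Submodule ℚ V) : IsQGroup (subSO q V') := by
  let b := finBasis ℚ V
  -- `P v w` says that `g` preserves the polar form at `v`, `w`, and `R w φ` that `φ (g w) = φ w`
  let P : V → V → MvPolynomial (V × Module.Dual ℚ V) ℚ := fun v w =>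
    (∑ i, ∑ j, MvPolynomial.C (polar q (b i) (b j)) * MvPolynomial.X (v, b.coord i) *
      MvPolynomial.X (w, b.coord j)) - MvPolynomial.C (polar q v w)
  let R : V → Module.Dual ℚ V → MvPolynomial (V × Module.Dual ℚ V) ℚ := fun w φ =>
    MvPolynomial.X (w, φ) - MvPolynomial.C (φ w)
  have hP (g : SpecialLinearGroup ℂ (ℂ ⊗[ℚ] V)) (v w : V) :
      MvPolynomial.aeval (matrixCoeff g) (P v w) = polar (q.baseChange ℂ)
        (g.val ((1 : ℂ) ⊗ₜ[ℚ] v)) (g.val ((1 : ℂ) ⊗ₜ[ℚ] w)) - (polar q v w : ℚ) := by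
    have h1 : polar (q.baseChange ℂ) (g.val ((1 : ℂ) ⊗ₜ[ℚ] v)) (g.val ((1 : ℂ) ⊗ₜ[ℚ] w)) =
        ∑ i, ∑ j, ((polar q (b i) (b j) : ℚ) : ℂ) * matrixCoeff g (v, b.coord i) *
          matrixCoeff g (w, b.coord j) := by
      rw [apply_one_tmul b g v, apply_one_tmul b g w, ← polarBilin_apply_apply,
        LinearMap.map_sum₂]
      refine Finset.sum_congr rfl fun i _ => ?_
      rw [map_sum]
      refine Finset.sum_congr rfl fun j _ => ?_
      rw [polarBilin_apply_apply, polar_baseChange_tmul]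
      ring
    rw [h1]
    simp [P]
  have hR (g : SpecialLinearGroup ℂ (ℂ ⊗[ℚ] V)) (w : V) (φ : Module.Dual ℚ V) :
      MvPolynomial.aeval (matrixCoeff g) (R w φ) = matrixCoeff g (w, φ) - (φ w : ℚ) := by
    simp [R]
  refine (isClosed_iff_zeroLocus ℚ).2
    ⟨{p | (∃ v w, p = P v w) ∨ ∃ w ∈ perp q V', ∃ φ, p = R w φ}, ?_⟩
  ext g
  constructor
  · rintro ⟨hg, hfix⟩ p (⟨v, w, rfl⟩ | ⟨w, hw, φ, rfl⟩)
    · rw [hP, mem_specialOrthogonal_iff_polar.1 hg, sub_self]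
    · have hgw : g.val ((1 : ℂ) ⊗ₜ[ℚ] w) = (1 : ℂ) ⊗ₜ[ℚ] w := hfix _ ⟨w, hw, rfl⟩
      rw [hR, matrixCoeff]
      change Module.Dual.baseChange ℂ φ (g.val ((1 : ℂ) ⊗ₜ[ℚ] w)) - _ = 0
      rw [hgw]
      simp
  · intro h
    refine ⟨mem_specialOrthogonal_iff_polar.2 fun v w => ?_, ?_⟩
    · have := h _ (Or.inl ⟨v, w, rfl⟩)
      rw [hP] at this
      exact sub_eq_zero.1 this
    · rintro _ ⟨w, hw, rfl⟩
      change g.val ((1 : ℂ) ⊗ₜ[ℚ] w) = (1 : ℂ) ⊗ₜ[ℚ] w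
      rw [apply_one_tmul b]
      have h1 (i) : matrixCoeff g (w, b.coord i) = (b.repr w i : ℚ) := by
        have := h _ (Or.inr ⟨w, hw, b.coord i, rfl⟩)
        rw [hR] at this
        exact sub_eq_zero.1 this
      conv_rhs => rw [← b.sum_repr w]
      rw [TensorProduct.tmul_sum]
      refine Finset.sum_congr rfl fun i _ => ?_
      rw [h1, ← TensorProduct.smul_tmul, Algebra.smul_def, mul_one]; rfl

theorem mem_subSO_iff {V' : Submodule ℚ V} (hV' : NondegenerateOn q V')
    {g : SpecialLinearGroup ℂ (ℂ ⊗[ℚ] V)} :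
    g ∈ subSO q V' ↔ g ∈ SO q ∧
      ∀ x, (∀ y ∈ V'.baseChange ℂ, polar (q.baseChange ℂ) y x = 0) → g.val x = x := by
  refine and_congr_right fun hg => ⟨fun h x hx => ?_, ?_⟩
  · rw [← mem_baseChange_perp_iff hV', Submodule.baseChange_eq_span] at hx
    induction hx using Submodule.span_induction with
    | zero => simp
    | add x x' _ _ hx hx' => rw [map_add, hx, hx']
    | smul a x _ hx => rw [map_smul, hx]
    | mem x hx => exact h x hx
  · rintro h _ ⟨w, hw, rfl⟩
    exact h _ ((mem_baseChange_perp_iff hV').1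
      (Submodule.tmul_mem_baseChange_of_mem (p := perpSubmodule q V') 1 hw))

theorem isAlgebraic_SO (hq : NondegenerateOn q ⊤) : IsAlgebraic (SO q) := by
  have h : subSO q ⊤ = SO q := by
    ext g
    refine (mem_subSO_iff hq).trans (and_iff_left fun x hx => ?_)
    rw [hq.baseChange x (by simp) hx, map_zero]
  rw [← h]
  exact (isQGroup_subSO q ⊤).isAlgebraic

theorem eichler_mem_subSO {V' : Submodule ℚ V} (hV' : NondegenerateOn q V') {e v : ℂ ⊗[ℚ] V}
    (he : e ∈ V'.baseChange ℂ) (hv : v ∈ V'.baseChange ℂ) (hQe : q.baseChange ℂ e = 0)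
    (hev : polar (q.baseChange ℂ) e v = 0) : eichler (q.baseChange ℂ) hQe hev ∈ subSO q V' := by
  refine (mem_subSO_iff hV').2 ⟨eichler_mem hQe hev, fun x hx => ?_⟩
  rw [eichler_apply, eichlerMap_of_orthogonal (hx e he) (hx v hv)]

/-! ### Connectedness and semisimplicity -/

theorem isZariskiConnected_subSO (hq : NondegenerateOn q ⊤) {V' : Submodule ℚ V}
    (hV' : NondegenerateOn q V') {e f a : ℂ ⊗[ℚ] V}
    (h : IsHyperbolicTriple (q.baseChange ℂ) (V'.baseChange ℂ) e f a) :
    IsZariskiConnected (subSO q V') := by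
  let S : Set (SpecialLinearGroup ℂ (ℂ ⊗[ℚ] V)) := {g | ∃ e' v, ∃ he : q.baseChange ℂ e' = 0,
    ∃ hev : polar (q.baseChange ℂ) e' v = 0, e' ∈ V'.baseChange ℂ ∧ v ∈ V'.baseChange ℂ ∧
      g = eichler (q.baseChange ℂ) he hev}
  have hS {e : ℂ ⊗[ℚ] V} (he : e ∈ V'.baseChange ℂ) (hQe : q.baseChange ℂ e = 0) :
      ContainsEichler (q.baseChange ℂ) (Subgroup.closure S) (V'.baseChange ℂ) e := fun v hv hev =>
    ⟨_, Subgroup.subset_closure ⟨e, v, hQe, hev, he, hv, rfl⟩, eichler_apply hQe hev⟩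
  have hM : NondegenerateOn (q.baseChange ℂ) ⊤ := by
    have := hq.baseChange; rwa [Submodule.baseChange_top] at this
  refine isConnected_of_closure (S := S) (fun g hg => ?_) ?_
  · obtain ⟨hgO, hgfix⟩ := (mem_subSO_iff hV').1 hg
    exact mem_of_containsEichler hM hV'.baseChange h (hS h.mem_e h.map_e) (hS h.mem_f h.map_f) g
      hgO hgfix
  · rintro _ ⟨e', v, hQe, hev, he', hv, rfl⟩
    exact exists_isPreconnected_eichler hQe hev fun t ht =>
      eichler_mem_subSO hV' he' (Submodule.smul_mem _ t hv) hQe ht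

/-- `SO(V')` acts irreducibly on `V' ⊗ ℂ`. -/
theorem le_or_orthogonal_of_subSO_stable {V' : Submodule ℚ V}
    (hV' : NondegenerateOn q V') {e f a : ℂ ⊗[ℚ] V}
    (h : IsHyperbolicTriple (q.baseChange ℂ) (V'.baseChange ℂ) e f a)
    {U : Submodule ℂ (ℂ ⊗[ℚ] V)} (hU : ∀ g ∈ subSO q V', ∀ x ∈ U, g.val x ∈ U) :
    V'.baseChange ℂ ≤ U ∨
      ∀ x ∈ U, ∀ y ∈ V'.baseChange ℂ, polar (q.baseChange ℂ) y x = 0 :=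
  le_or_orthogonal_of_eichler_stable h
    (fun v hv hev x hx => by
      rw [← eichler_apply h.map_e hev]
      exact hU _ (eichler_mem_subSO hV' h.mem_e hv _ _) x hx)
    (fun v hv hev x hx => by
      rw [← eichler_apply h.map_f hev]
      exact hU _ (eichler_mem_subSO hV' h.mem_f hv _ _) x hx)

/-- A connected group of isometries acts trivially on an anisotropic eigenvector. -/
theorem apply_eq_self_of_anisotropic {N : Subgroup (SpecialLinearGroup ℂ (ℂ ⊗[ℚ] V))}
    (hN : IsZariskiConnected N) (hNO : N ≤ SO q) {x : ℂ ⊗[ℚ] V} (hx : q.baseChange ℂ x ≠ 0)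
    (hxe : ∀ n ∈ N, ∃ c : ℂ, n.val x = c • x) {n : SpecialLinearGroup ℂ (ℂ ⊗[ℚ] V)} (hn : n ∈ N) :
    n.val x = x := by
  refine apply_eq_self_of_finite hN (by rintro rfl; simp at hx) (s := {1, -1}) (by simp)
    (fun n hn => ?_) hn
  obtain ⟨c, hc⟩ := hxe n hn
  have h1 : q.baseChange ℂ (n.val x) = q.baseChange ℂ x := hNO hn x
  rw [hc, QuadraticMap.map_smul, smul_eq_mul] at h1
  have h2 : c * c = 1 := mul_right_cancel₀ hx (by rw [h1, one_mul])
  exact ⟨c, mul_self_eq_one_iff.1 h2, hc⟩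

theorem isSemisimpleQGroup_subSO (hq : NondegenerateOn q ⊤) {V' : Submodule ℚ V}
    (hV' : NondegenerateOn q V') {e f a : ℂ ⊗[ℚ] V}
    (h : IsHyperbolicTriple (q.baseChange ℂ) (V'.baseChange ℂ) e f a) :
    IsSemisimpleQGroup (subSO q V') := by
  refine ⟨isQGroup_subSO q V', isZariskiConnected_subSO hq hV' h, ?_⟩
  intro N hNH hnormal _ hN hsol
  have hW0 : V'.baseChange ℂ ≠ ⊥ := fun h0 => by
    have := h.mem_a
    rw [h0, Submodule.mem_bot] at this
    have h1 := h.map_a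
    rw [this, QuadraticMap.map_zero] at h1
    exact zero_ne_one h1
  have hM : NondegenerateOn (q.baseChange ℂ) ⊤ := by
    have := hq.baseChange; rwa [Submodule.baseChange_top] at this
  obtain ⟨w, hw, hw0, hwN⟩ := exists_eigenvector_of_isSolvable hN hsol hW0
    fun g hg x hx => hV'.baseChange.apply_mem hM (hNH hg).1
      ((mem_subSO_iff hV').1 (hNH hg)).2 hx
  choose! χ hχ using hwN
  -- the weight space is stable under `SO(V')`, hence contains `V' ⊗ ℂ`
  have hstab : ∀ g ∈ subSO q V', ∀ x ∈ weightSpace N χ, g.val x ∈ weightSpace N χ :=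
    fun g hg x hx => weightSpace_stable (isZariskiConnected_subSO hq hV' h)
      (fun g hg n hn => by
        have := hnormal.conj_mem ⟨n, hNH hn⟩ hn ⟨g⁻¹, (subSO q V').inv_mem hg⟩
        rw [Subgroup.mem_subgroupOf] at this
        simpa using this) hx hg
  have hle : V'.baseChange ℂ ≤ weightSpace N χ := by
    refine (le_or_orthogonal_of_subSO_stable hV' h hstab).resolve_right fun horth => hw0 ?_
    exact hV'.baseChange w hw fun y hy => horth w hχ y hy
  -- the scalars by which `N` acts are trivial, since they are so on an anisotropic vector
  have htriv : ∀ n ∈ N, χ n = 1 := fun n hn => by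
    have ha : q.baseChange ℂ a ≠ 0 := by rw [h.map_a]; exact one_ne_zero
    have h1 := apply_eq_self_of_anisotropic hN (fun n hn => (hNH hn).1) ha
      (fun n hn => ⟨χ n, hle h.mem_a n hn⟩) hn
    rw [hle h.mem_a n hn] at h1
    exact smul_left_injective ℂ (fun ha0 => ha (by rw [ha0, QuadraticMap.map_zero]))
      (h1.trans (one_smul ℂ a).symm)
  refine (Subgroup.eq_bot_iff_forall _).2 fun n hn => SpecialLinearGroup.ext _ _ fun x => ?_
  obtain ⟨y, hy, hxy⟩ := hV'.baseChange.exists_sub_orthogonal x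
  change n.val x = x
  have h1 : n.val (x - y) = x - y := ((mem_subSO_iff hV').1 (hNH hn)).2 _ hxy
  have h2 : n.val y = y := by rw [hle hy n hn, htriv n hn, one_smul]
  rw [← sub_add_cancel x y, map_add, h1, h2]

end Groups

section Parabolic

variable {V : Type*} [AddCommGroup V] [Module ℚ V] {q : QuadraticForm ℚ V}

attribute [local instance] zariskiTopology

/-! ### Vectors with Eichler transformations in a given group -/

/-- The set of `e` whose Eichler transformations lie in a `ℚ`-group is stable under complex
conjugation. -/
theorem containsEichler_conjTensor {P : Subgroup (SpecialLinearGroup ℂ (ℂ ⊗[ℚ] V))}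
    (hP : IsQGroup P) {e : ℂ ⊗[ℚ] V} (he : q.baseChange ℂ e = 0)
    (h : ContainsEichler (q.baseChange ℂ) P ⊤ e) :
    ContainsEichler (q.baseChange ℂ) P ⊤ (conjTensor V e) := by
  intro v _ hv
  set w := conjTensor V v with hw
  have hvw : v = conjTensor V w := (conjTensor_conjTensor v).symm
  have hew : polar (q.baseChange ℂ) e w = 0 := by
    have := polar_conjTensor q e w
    rw [← hvw, hv] at this
    exact (map_eq_zero (starRingEnd ℂ)).1 this.symm
  have he' : q.baseChange ℂ (conjTensor V e) = 0 := by rw [map_conjTensor, he, map_zero]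
  refine ⟨eichler _ he' hv, ?_, eichler_apply he' hv⟩
  obtain ⟨g, hg, hgx⟩ := h w trivial hew
  obtain ⟨I, hI⟩ := (isClosed_iff_zeroLocus ℚ).1 hP
  have hcoeff : matrixCoeff (eichler _ he' hv) =
      fun i => (Complex.conjAe.restrictScalars ℚ : ℂ →ₐ[ℚ] ℂ) (matrixCoeff g i) := by
    ext i
    change Module.Dual.baseChange ℂ i.2 ((eichler _ he' hv).val ((1 : ℂ) ⊗ₜ[ℚ] i.1)) =
      starRingEnd ℂ (Module.Dual.baseChange ℂ i.2 (g.val ((1 : ℂ) ⊗ₜ[ℚ] i.1)))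
    have h1 : (1 : ℂ) ⊗ₜ[ℚ] i.1 = conjTensor V ((1 : ℂ) ⊗ₜ[ℚ] i.1) := by
      rw [conjTensor_tmul, map_one]
    rw [eichler_apply, hgx, ← dual_baseChange_conjTensor, ← eichlerMap_conjTensor, ← h1, ← hvw]
  have hmem : eichler _ he' hv ∈ (P : Set (SpecialLinearGroup ℂ (ℂ ⊗[ℚ] V))) := by
    rw [hI]
    intro p hp
    have hg' : g ∈ (P : Set (SpecialLinearGroup ℂ (ℂ ⊗[ℚ] V))) := hg
    rw [hI] at hg'
    rw [hcoeff, ← MvPolynomial.comp_aeval_apply, hg' p hp, map_zero]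
  exact hmem

/-- The set of `e` whose Eichler transformations lie in a group of isometries is stable under this
group. -/
theorem containsEichler_apply {P : Subgroup (SpecialLinearGroup ℂ (ℂ ⊗[ℚ] V))} (hPO : P ≤ SO q)
    {e : ℂ ⊗[ℚ] V} (h : ContainsEichler (q.baseChange ℂ) P ⊤ e)
    {g : SpecialLinearGroup ℂ (ℂ ⊗[ℚ] V)} (hg : g ∈ P) :
    ContainsEichler (q.baseChange ℂ) P ⊤ (g.val e) := by
  intro v _ hv
  obtain ⟨w, rfl⟩ := g.val.surjective v
  rw [polar_map_eq (hPO hg)] at hv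
  obtain ⟨k, hk, hkx⟩ := h w trivial hv
  refine ⟨g * k * g⁻¹, P.mul_mem (P.mul_mem hg hk) (P.inv_mem hg), fun x => ?_⟩
  change g.val (k.val (g.val.symm x)) = _
  rw [hkx]
  refine (eichlerMap_conj (g := (g.val : (ℂ ⊗[ℚ] V) →ₗ[ℂ] (ℂ ⊗[ℚ] V))) (hPO hg) e w _).trans ?_
  exact congrArg _ (g.val.apply_symm_apply x)

/-! ### Borel subgroups contain Eichler transformations -/

variable (q) in
/-- The group of all Eichler transformations attached to the isotropic vector `e`. -/
def eichlerGroup {e : ℂ ⊗[ℚ] V} (he : q.baseChange ℂ e = 0) :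
    Subgroup (SpecialLinearGroup ℂ (ℂ ⊗[ℚ] V)) where
  carrier := {g | ∃ v, ∃ hv : polar (q.baseChange ℂ) e v = 0, g = eichler (q.baseChange ℂ) he hv}
  one_mem' := by
    refine ⟨0, polar_zero_right _ _, SpecialLinearGroup.ext _ _ fun x => ?_⟩
    refine Eq.trans ?_ (eichler_apply he (polar_zero_right _ e) x).symm
    simp [eichlerMap]
  mul_mem' := by
    rintro _ _ ⟨v, hv, rfl⟩ ⟨w, hw, rfl⟩
    have hvw : polar (q.baseChange ℂ) e (v + w) = 0 := by rw [polar_add_right, hv, hw, add_zero]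
    refine ⟨v + w, hvw, SpecialLinearGroup.ext _ _ fun x => ?_⟩
    change (eichler _ he hv).val ((eichler _ he hw).val x) = (eichler _ he hvw).val x
    rw [eichler_apply, eichler_apply, eichler_apply, eichlerMap_add he hv hw]
  inv_mem' := by
    rintro _ ⟨v, hv, rfl⟩
    have hnv : polar (q.baseChange ℂ) e (-v) = 0 := by rw [polar_neg_right, hv, neg_zero]
    refine ⟨-v, hnv, SpecialLinearGroup.ext _ _ fun x => ?_⟩
    change (eichler _ he hv).val.symm x = (eichler _ he hnv).val x
    rw [LinearEquiv.symm_apply_eq, eichler_apply, eichler_apply]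
    have := eichlerMap_neg_eichlerMap he hnv x
    rw [neg_neg] at this
    exact this.symm

theorem eichlerGroup_mul_comm {e : ℂ ⊗[ℚ] V} (he : q.baseChange ℂ e = 0)
    {g h : SpecialLinearGroup ℂ (ℂ ⊗[ℚ] V)} (hg : g ∈ eichlerGroup q he)
    (hh : h ∈ eichlerGroup q he) : g * h = h * g := by
  obtain ⟨v, hv, rfl⟩ := hg
  obtain ⟨w, hw, rfl⟩ := hh
  refine SpecialLinearGroup.ext _ _ fun x => ?_
  change (eichler _ he hv).val ((eichler _ he hw).val x) =
    (eichler _ he hw).val ((eichler _ he hv).val x)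
  rw [eichler_apply, eichler_apply, eichler_apply, eichler_apply, eichlerMap_add he hv hw,
    eichlerMap_add he hw hv, add_comm]

/-- Isometries which preserve the line spanned by `e` normalize the group of Eichler
transformations attached to `e`. -/
theorem conj_mem_eichlerGroup {e : ℂ ⊗[ℚ] V} (he : q.baseChange ℂ e = 0)
    {b n : SpecialLinearGroup ℂ (ℂ ⊗[ℚ] V)} (hb : b ∈ SO q) {c : ℂ} (hbe : b.val e = c • e)
    (hn : n ∈ eichlerGroup q he) : b * n * b⁻¹ ∈ eichlerGroup q he := by
  obtain ⟨v, hv, rfl⟩ := hn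
  have hc : polar (q.baseChange ℂ) e (c • b.val v) = 0 := by
    rw [polar_smul_right, ← polar_smul_left, ← hbe, polar_map_eq hb, hv]
  refine ⟨c • b.val v, hc, SpecialLinearGroup.ext _ _ fun x => ?_⟩
  change b.val ((eichler _ he hv).val (b.val.symm x)) = (eichler _ he hc).val x
  rw [eichler_apply, eichler_apply, ← eichlerMap_smul_left, ← hbe]
  refine (eichlerMap_conj (g := (b.val : (ℂ ⊗[ℚ] V) →ₗ[ℂ] (ℂ ⊗[ℚ] V))) hb e v _).trans ?_
  exact congrArg _ (b.val.apply_symm_apply x)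

/-- The product of two subgroups, the second of which is normalized by the first. -/
def mulSubgroup {A : Type*} [Group A] (B N : Subgroup A)
    (h : ∀ b ∈ B, ∀ n ∈ N, b * n * b⁻¹ ∈ N) : Subgroup A where
  carrier := {g | ∃ b ∈ B, ∃ n ∈ N, g = b * n}
  one_mem' := ⟨1, B.one_mem, 1, N.one_mem, (mul_one 1).symm⟩
  mul_mem' := by
    rintro _ _ ⟨b, hb, n, hn, rfl⟩ ⟨b', hb', n', hn', rfl⟩
    have := h _ (B.inv_mem hb') n hn
    rw [inv_inv] at this
    exact ⟨b * b', B.mul_mem hb hb', _, N.mul_mem this hn', by group⟩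
  inv_mem' := by
    rintro _ ⟨b, hb, n, hn, rfl⟩
    exact ⟨b⁻¹, B.inv_mem hb, _, h b hb _ (N.inv_mem hn), by group⟩

theorem isSolvable_mulSubgroup {A : Type*} [Group A] {B N : Subgroup A}
    (h : ∀ b ∈ B, ∀ n ∈ N, b * n * b⁻¹ ∈ N) (hB : Group.IsSolvable B)
    (hN : ∀ m ∈ N, ∀ n ∈ N, m * n = n * m) : Group.IsSolvable (mulSubgroup B N h) := by
  let T := mulSubgroup B N h
  have hBT : B ≤ T := fun b hb => ⟨b, hb, 1, N.one_mem, (mul_one b).symm⟩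
  have hNT : N ≤ T := fun n hn => ⟨1, B.one_mem, n, hn, (one_mul n).symm⟩
  have : (N.subgroupOf T).Normal := ⟨by
    rintro ⟨n, hnT⟩ hn ⟨_, b, hb, m, hm, rfl⟩
    rw [Subgroup.mem_subgroupOf] at hn ⊢
    have := h b hb _ (N.mul_mem (N.mul_mem hm hn) (N.inv_mem hm))
    simpa [mul_assoc] using this⟩
  have : Group.IsSolvable N := Group.isSolvable_of_comm fun a b => Subtype.ext (hN a a.2 b b.2)
  have hsurj : Function.Surjective
      ((QuotientGroup.mk' (N.subgroupOf T)).comp (Subgroup.inclusion hBT)) := by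
    intro y
    obtain ⟨⟨_, b, hb, n, hn, rfl⟩, rfl⟩ := QuotientGroup.mk'_surjective _ y
    refine ⟨⟨b, hb⟩, ?_⟩
    refine (QuotientGroup.mk'_eq_mk' _).2 ⟨⟨n, hNT hn⟩, hn, rfl⟩
  have : Group.IsSolvable (T ⧸ N.subgroupOf T) := Group.isSolvable_of_surjective hsurj
  refine Group.isSolvable_of_ker_le_range (Subgroup.inclusion hNT)
    (QuotientGroup.mk' (N.subgroupOf T)) ?_
  rw [QuotientGroup.ker_mk']
  intro x hx
  exact ⟨⟨x, hx⟩, rfl⟩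

variable [FiniteDimensional ℚ V]

/-- A Borel subgroup preserving an isotropic line contains the Eichler transformations attached to
it: together with them, it generates a connected solvable group. -/
theorem IsBorel.eichler_mem (hq : NondegenerateOn q ⊤)
    {B : Subgroup (SpecialLinearGroup ℂ (ℂ ⊗[ℚ] V))} (hB : IsBorel (SO q) B) {e : ℂ ⊗[ℚ] V}
    (he : q.baseChange ℂ e = 0) (hBe : ∀ b ∈ B, ∃ c : ℂ, b.val e = c • e) {v : ℂ ⊗[ℚ] V}
    (hv : polar (q.baseChange ℂ) e v = 0) : eichler (q.baseChange ℂ) he hv ∈ B := by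
  obtain ⟨hBO, -, hBconn, hBsol⟩ := hB.prop
  have hnorm : ∀ b ∈ B, ∀ n ∈ eichlerGroup q he, b * n * b⁻¹ ∈ eichlerGroup q he :=
    fun b hb n hn => by
      obtain ⟨c, hc⟩ := hBe b hb
      exact conj_mem_eichlerGroup he (hBO hb) hc hn
  let T := mulSubgroup B (eichlerGroup q he) hnorm
  have hBT : B ≤ T := fun b hb => ⟨b, hb, 1, one_mem _, (mul_one b).symm⟩
  have hNT : eichlerGroup q he ≤ T := fun n hn => ⟨1, B.one_mem, n, hn, (one_mul n).symm⟩
  have hTO : T ≤ SO q := by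
    rintro _ ⟨b, hb, _, ⟨v, hv, rfl⟩, rfl⟩
    exact (SO q).mul_mem (hBO hb) (OrthogonalShimura.eichler_mem he hv)
  have hTconn : IsZariskiConnected T := by
    refine isConnected_of_closure (S := (B : Set (SpecialLinearGroup ℂ (ℂ ⊗[ℚ] V))) ∪
      eichlerGroup q he) ?_ ?_
    · rintro _ ⟨b, hb, n, hn, rfl⟩
      exact mul_mem (Subgroup.subset_closure (Or.inl hb)) (Subgroup.subset_closure (Or.inr hn))
    · rintro s (hs | ⟨v, hv, rfl⟩)
      · exact ⟨B, hBT, hBconn.isPreconnected, B.one_mem, hs⟩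
      · exact exists_isPreconnected_eichler he hv fun t ht => hNT ⟨_, ht, rfl⟩
  have hTsol : Group.IsSolvable T := isSolvable_mulSubgroup hnorm hBsol
    fun m hm n hn => eichlerGroup_mul_comm he hm hn
  have hle : zariskiClosure T ≤ B := hB.le_of_ge
    ⟨zariskiClosure_le hTO (isAlgebraic_SO hq), isAlgebraic_zariskiClosure T,
      hTconn.zariskiClosure, isSolvable_zariskiClosure hTsol⟩
    (hBT.trans (le_zariskiClosure T))
  exact hle (le_zariskiClosure T (hNT ⟨v, hv, rfl⟩))

/-- A connected solvable group of isometries preserves an isotropic line. If the eigenvectors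
provided by the Lie–Kolchin theorem are anisotropic, two orthogonal ones are fixed, and span an
isotropic fixed vector. -/
theorem exists_isotropic_eigenvector (h2 : 2 ≤ finrank ℚ V)
    {B : Subgroup (SpecialLinearGroup ℂ (ℂ ⊗[ℚ] V))} (hBO : B ≤ SO q)
    (hconn : IsZariskiConnected B) (hsol : Group.IsSolvable B) :
    ∃ e : ℂ ⊗[ℚ] V, e ≠ 0 ∧ q.baseChange ℂ e = 0 ∧ ∀ b ∈ B, ∃ c : ℂ, b.val e = c • e := by
  set Q := q.baseChange ℂ with hQ
  have hfin : finrank ℂ (⊤ : Submodule ℂ (ℂ ⊗[ℚ] V)) = finrank ℚ V := by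
    rw [finrank_top, finrank_baseChange]
  obtain ⟨w, -, hw0, hw⟩ := exists_eigenvector_of_isSolvable hconn hsol
    (W := (⊤ : Submodule ℂ (ℂ ⊗[ℚ] V))) (by intro h; rw [h, finrank_bot] at hfin; omega)
    (fun _ _ _ _ => trivial)
  by_cases hQw : Q w = 0
  · exact ⟨w, hw0, hQw, hw⟩
  have hfix := fun b (hb : b ∈ B) => apply_eq_self_of_anisotropic hconn hBO hQw hw hb
  obtain ⟨w', hw', hw'0, hw'B⟩ := exists_eigenvector_of_isSolvable hconn hsol
    (W := perpIn Q ⊤ w)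
    (by
      intro h
      have := finrank_le_perpIn (Q := Q) ⊤ w
      rw [h, finrank_bot, hfin] at this
      omega)
    (fun b hb x hx => mem_perpIn.2 ⟨trivial, by
      have := polar_map_eq (hBO hb) w x
      rw [hfix b hb] at this
      exact this.trans (mem_perpIn.1 hx).2⟩)
  have hww' : polar Q w w' = 0 := (mem_perpIn.1 hw').2
  by_cases hQw' : Q w' = 0
  · exact ⟨w', hw'0, hQw', hw'B⟩
  have hfix' := fun b (hb : b ∈ B) => apply_eq_self_of_anisotropic hconn hBO hQw' hw'B hb
  obtain ⟨c, hc⟩ := IsAlgClosed.exists_pow_nat_eq (-(Q w / Q w')) two_pos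
  refine ⟨w + c • w', fun h0 => ?_, ?_, fun b hb => ⟨1, ?_⟩⟩
  · have h1 : polar Q w (w + c • w') = 2 * Q w := by
      rw [polar_add_right, polar_smul_right, hww', polar_self, nsmul_eq_mul]; simp
    rw [h0, polar_zero_right] at h1
    exact mul_ne_zero two_ne_zero hQw h1.symm
  · rw [QuadraticMap.map_add Q, QuadraticMap.map_smul, polar_smul_right, hww', ← pow_two, hc,
      smul_eq_mul, neg_mul, div_mul_cancel₀ _ hQw', smul_zero]
    ring
  · rw [map_add, map_smul, hfix b hb, hfix' b hb, one_smul]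

/-! ### Parabolic subgroups containing the group of a subspace -/

/-- A parabolic `ℚ`-subgroup containing `SO(V')` is the whole group if the orthogonal complement of
`V'` is positive definite. -/
theorem IsParabolicQSubgroup.eq_top_of_subSO_le (hq : NondegenerateOn q ⊤)
    (h3 : 3 ≤ finrank ℚ V) {V' : Submodule ℚ V} (hV' : NondegenerateOn q V')
    (hpos : ∀ v ∈ perp q V', v ≠ 0 → 0 < q v) {e₀ f₀ a₀ : ℂ ⊗[ℚ] V}
    (h : IsHyperbolicTriple (q.baseChange ℂ) (V'.baseChange ℂ) e₀ f₀ a₀)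
    {P : Subgroup (SpecialLinearGroup ℂ (ℂ ⊗[ℚ] V))} (hP : IsParabolicQSubgroup (SO q) P)
    (hle : subSO q V' ≤ P) : P = SO q := by
  obtain ⟨hPO, hPQ, B, hB, hBP⟩ := hP
  set Q := q.baseChange ℂ with hQ
  have hM : NondegenerateOn Q ⊤ := by
    have := hq.baseChange; rwa [Submodule.baseChange_top] at this
  let I : Set (ℂ ⊗[ℚ] V) := {e | Q e = 0 ∧ ContainsEichler Q P ⊤ e}
  -- it suffices to find two vectors of `I` which are not orthogonal to each other
  suffices hI : ∃ e ∈ I, ∃ f ∈ I, polar Q e f ≠ 0 by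
    obtain ⟨e, ⟨hQe, he⟩, f, ⟨hQf, hf⟩, hef⟩ := hI
    obtain ⟨a, ha⟩ := exists_isHyperbolicTriple_of_pair (W := ⊤) hM
      (by rwa [finrank_top, finrank_baseChange]) (e := e) (f := (polar Q e f)⁻¹ • f) trivial trivial
      hQe (by rw [QuadraticMap.map_smul, hQf, smul_zero])
      (by rw [polar_smul_right, smul_eq_mul, inv_mul_cancel₀ hef])
    refine le_antisymm hPO fun g hg => mem_of_containsEichler hM hM ha he ?_ g hg
      fun x hx => by rw [hM x trivial hx, map_zero]
    intro v _ hv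
    obtain ⟨k, hk, hkx⟩ := hf ((polar Q e f)⁻¹ • v) trivial (by
      rw [polar_smul_right, ← polar_smul_left, hv])
    exact ⟨k, hk, fun x => by rw [hkx, eichlerMap_smul_left]⟩
  by_contra! hcon
  obtain ⟨e, he0, hQe, hBe⟩ := exists_isotropic_eigenvector (by omega) hB.prop.1 hB.prop.2.2.1
    hB.prop.2.2.2
  have heI : e ∈ I := ⟨hQe, fun v _ hv =>
    ⟨_, hBP (hB.eichler_mem hq hQe hBe hv), eichler_apply hQe hv⟩⟩
  have heI' : conjTensor V e ∈ I :=
    ⟨by rw [hQ, map_conjTensor, hQe, map_zero], containsEichler_conjTensor hPQ hQe heI.2⟩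
  -- the span of `I` is totally isotropic and stable under `SO(V')`
  let U := Submodule.span ℂ I
  have hUU : ∀ x ∈ U, ∀ y ∈ U, polar Q x y = 0 := fun x hx y hy => by
    induction hx using Submodule.span_induction with
    | zero => simp
    | add x x' _ _ hx hx' => rw [polar_add_left, hx, hx', add_zero]
    | smul a x _ hx => rw [polar_smul_left, hx, smul_zero]
    | mem x hx =>
      induction hy using Submodule.span_induction with
      | zero => simp
      | add x x' _ _ hx hx' => rw [polar_add_right, hx, hx', add_zero]
      | smul a x _ hx => rw [polar_smul_right, hx, smul_zero]
      | mem y hy => exact hcon x hx y hy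
  have hU : ∀ g ∈ subSO q V', ∀ x ∈ U, g.val x ∈ U := fun g hg x hx => by
    induction hx using Submodule.span_induction with
    | zero => simp
    | add x x' _ _ hx hx' => rw [map_add]; exact U.add_mem hx hx'
    | smul a x _ hx => rw [map_smul]; exact U.smul_mem a hx
    | mem x hx =>
      exact Submodule.subset_span ⟨(hPO (hle hg) x).trans hx.1,
        containsEichler_apply hPO hx.2 (hle hg)⟩
  rcases le_or_orthogonal_of_subSO_stable hV' h hU with hWU | horth
  · have := hUU _ (hWU h.mem_e) _ (hWU h.mem_f)
    rw [h.polar_ef] at this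
    exact one_ne_zero this
  · exact polar_conjTensor_ne_zero (U := perpSubmodule q V') hpos
      ((mem_baseChange_perp_iff hV').2 (horth e (Submodule.subset_span heI))) he0
      (hcon _ heI' _ heI)

theorem isStronglySpecialGroup_subSO {n r : ℕ} (hn : 1 ≤ n) (hr : 1 ≤ r)
    (hq : HasSignature q n 2) {V' : Submodule ℚ V} (hV' : HasSignature (q.restrict V') r 2) :
    IsStronglySpecialGroup q (subSO q V') := by
  have hqn := hq.nondegenerateOn_top
  have hVn := hV'.nondegenerateOn
  obtain ⟨e, f, a, h⟩ := exists_isHyperbolicTriple hVn.baseChange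
    (by rw [finrank_baseChange_submodule, hV'.2.2]; omega)
  refine ⟨isSemisimpleQGroup_subSO hqn hVn h, fun P hP hne hle => hne ?_⟩
  exact hP.eq_top_of_subSO_le hqn (by rw [hq.2.2]; omega) hVn
    (fun v hv hv0 => hq.pos_of_orthogonal hV' hv hv0) h hle

end Parabolic

end OrthogonalShimura

end

theorem mainTheorem8 {V : Type*} [AddCommGroup V] [Module ℚ V] [FiniteDimensional ℚ V]
    (q : QuadraticForm ℚ V) (n : ℕ) (hn : 1 ≤ n) (hq : HasSignature q n 2) :
    (∀ Γ : Subgroup (SpecialLinearGroup ℚ V), IsArithmetic q Γ →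
      ∀ K : Subgroup (SpecialLinearGroup ℝ (TensorProduct ℚ ℝ V)), IsMaximalCompact q K →
        ∀ Z : Set (ShimuraVariety q Γ K),
          IsOrthogonalSubvariety q Γ K Z → IsStronglySpecial q Γ K Z) ∧
    (∀ (V' : Submodule ℚ V) (r : ℕ), 1 ≤ r → HasSignature (q.restrict V') r 2 →
      subSO q V' ≤ SO q ∧ IsStronglySpecialGroup q (subSO q V')) := by
  refine ⟨?_, fun V' r hr hV' => ⟨fun g hg => hg.1, isStronglySpecialGroup_subSO hn hr hq hV'⟩⟩
  rintro Γ - K - Z ⟨V', r, hr, hV', hZ⟩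
  exact ⟨subSO q V', hZ, isStronglySpecialGroup_subSO hn hr hq hV'⟩
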